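/- **Setting.** Let $\eta\in\{0,1\}^{\mathbb Z}$ be a non-periodic Toeplitz sequence with period structure $p_1\mid p_2\mid\cdots\to\infty$: every $k\in\mathbb Z$ has an $n$ such that $\eta$ is constant on $k+p_n\mathbb Z$, and (essentiality) for every $n$ there is $N$ such that $p_n$ divides every common period of the two sets $\mathcal P_N^0,\mathcal P_N^1$, where $\mathcal P_n^i=\{k:\eta|_{k+p_n\mathbb Z}\equiv i\}$ (e.g. every $p_n$ is an essential period of $\eta$). Let $X_\eta$ be the orbit closure of $\eta$ under the left shift $\sigma$, $G=\varprojlim\mathbb Z/p_n\mathbb Z$, $\Delta:\mathbb Z\to G$ the diagonal embedding, and $\pi:X_\eta\to G$ the unique continuous map with $\pi\circ\sigma=\pi+\Delta(1)$ and $\pi(\eta)=0$. Let $W\subseteq G$ be the closure of $V^1=\bigcup_n\bigcup_{k\in\mathcal P_n^1\cap[0,p_n)}\{g\in G:g_n=k\}$, and $\partial W$ its boundary. Put $\mathcal H_n=\mathbb Z\setminus(\mathcal P_n^0\cup\mathcal P_n^1)$ and $\widetilde{\mathcal H}_N=\{k\in\mathcal H_N:\mathcal H_n\cap(k+p_N\mathbb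 Z)\ne\emptyset\ \text{for all } n\ge N\}$ (essential holes), and let $\tilde\tau_n$ be the minimal period of $\widetilde{\mathcal H}_n$. The automorphism group (centralizer) of $(X_\eta,\sigma)$ is the group of homeomorphisms of $X_\eta$ commuting with $\sigma$; it is trivial if it consists of the powers of $\sigma$. For an automorphism $F$ put $y_F=\pi(F(\eta))$ (so $\pi(F(x))=\pi(x)+y_F$ for all $x\in X_\eta$), $V_k=\partial W\cap(\partial W+\Delta(k)-y_F)$ and $K=K_F=\{k\in\mathbb Z:\operatorname{int}_{\partial W}(V_k)\neq\emptyset\}$. For a set $B$ of integers let $\mathcal M_B=\bigcup_{b\in B}b\mathbb Z$. For an integer $a$, $a\mid (y_F)_n-k$ means $(y_F)_n-k\in a\,(\mathbb Z/p_n\mathbb Z)$. **Assumptions.** (AS) For every $n$ there are a primitive set $A_n$ of positive integers and, for each $a\in A_n$, a set $S_n(a)$ of positive integers with $$\widetilde{\mathcal H}_n=\bigcup_{a\in A_n}\bigl(a\mathbb Z\setminus\mathcal M_{S_n(a)}\bigr),\qquad a\mathbb Z\setminus\mathcal M_{S_n(a)}\ne\emptyset\quad(a\in A_n).$$ Moreover,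 for every choice of $a_n\in A_n$ ($n\ge1$), $$\lim_{n\to\infty}\ \sum_{a'\in A_n\setminus\{a_n\}}\frac1{\varphi\bigl(a'/\gcd(a',a_n)\bigr)}=0 .$$ **Theorem.** Let $F$ be an automorphism of $(X_\eta,\sigma)$ described by a block code $\{0,1\}^{[-m:m]}\to\{0,1\}$, and $K=K_F$. a) For each $n$ and each $k\in K$ there is $a\in A_n$ with $a\mid (y_F)_n-k$. b) For each $n$ and each $a\in A_n$ there is $k\in K$ with $a\mid (y_F)_n-k$. If $a>2m$, this $k\in K$ is unique; denote it by $\kappa_n(a)$. c) Suppose $\min A_n>2m$, and let $\mathcal G_n$ be the graph with vertex set $A_n$ and an edge between distinct $a,a'$ whenever $\gcd(a,a')>2m$. Then $\kappa_n(a)=\kappa_n(a')$ whenever $a,a'$ lie in the same connected component of $\mathcal G_n$. In particular $|K|=1$ if $\mathcal G_n$ is connected. d) If $K=\{k\}$, then $\tilde\tau_n\mid (y_F)_n-k$ for every $n$. e) Suppose $\tilde\tau_n=p_n$ for all $n$. If $|K_F|=1$, then $F$ is a power of $\sigma$. Consequently, if $|K_{F'}|=1$ for every automorphism $F'$ of $(X_\eta,\sigma)$,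 then $(X_\eta,\sigma)$ has a trivial centralizer. -/

import Mathlib

open Set Filter Topology
open scoped ENNReal

namespace ToeplitzShift

/-! ## Subshifts of `{0,1}^ℤ` -/

/-- The left shift `(σ x)_i = x_{i+1}` on `{0,1}^ℤ` (product topology). -/
def fullShift : (ℤ → Bool) ≃ₜ (ℤ → Bool) where
  toFun x := fun i => x (i + 1)
  invFun x := fun i => x (i - 1)
  left_inv x := by funext i; simp
  right_inv x := by funext i; simp
  continuous_toFun := by fun_prop
  continuous_invFun := by fun_prop

/-- The orbit closure `X_η` of `η` under the shift. -/
def orbitClosure (η : ℤ → Bool) : Set (ℤ → Bool) :=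
  closure (range fun k : ℤ => fun i : ℤ => η (i + k))

theorem self_mem_orbitClosure (η : ℤ → Bool) : η ∈ orbitClosure η :=
  subset_closure ⟨0, by simp⟩

theorem fullShift_image_orbitClosure (η : ℤ → Bool) :
    fullShift '' orbitClosure η = orbitClosure η := by
  unfold orbitClosure
  rw [fullShift.image_closure]
  congr 1
  ext z
  constructor
  · rintro ⟨_, ⟨k, rfl⟩, rfl⟩
    refine ⟨k + 1, ?_⟩
    funext i
    change η (i + (k + 1)) = η (i + 1 + k)
    congr 1
    ring
  · rintro ⟨k, rfl⟩
    refine ⟨_, ⟨k - 1, rfl⟩, ?_⟩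
    funext i
    change η (i + 1 + (k - 1)) = η (i + k)
    congr 1
    ring

theorem mem_orbitClosure_iff_fullShift (η x : ℤ → Bool) :
    x ∈ orbitClosure η ↔ fullShift x ∈ orbitClosure η := by
  conv_rhs => rw [← fullShift_image_orbitClosure η]
  exact (fullShift.injective.mem_set_image).symm

/-- The shift, as a homeomorphism of `X_η`. -/
def shift (η : ℤ → Bool) : orbitClosure η ≃ₜ orbitClosure η :=
  fullShift.subtype (mem_orbitClosure_iff_fullShift η)

/-- The point `η` of `X_η`. -/
def base (η : ℤ → Bool) : orbitClosure η := ⟨η, self_mem_orbitClosure η⟩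

/-- The automorphism group (centralizer) of `(X_η, σ)`: the homeomorphisms of `X_η` that commute
with `σ`. -/
def automorphismGroup (η : ℤ → Bool) : Subgroup (orbitClosure η ≃ₜ orbitClosure η) :=
  Subgroup.centralizer {shift η}

/-- `F` is described by a block code `{0,1}^{[-m:m]} → {0,1}`. -/
def HasBlockCode {η : ℤ → Bool} (F : orbitClosure η ≃ₜ orbitClosure η) (m : ℕ) : Prop :=
  ∃ f : (Icc (-(m : ℤ)) m → Bool) → Bool,
    ∀ (x : orbitClosure η) (i : ℤ), (F x : ℤ → Bool) i = f fun j => (x : ℤ → Bool) (i + j)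

/-! ## Odometers -/

/-- A sequence of positive integers `p₀ ∣ p₁ ∣ p₂ ∣ … → ∞`. -/
structure PeriodChain where
  p : ℕ → ℕ
  pos : ∀ n, 0 < p n
  dvd_succ : ∀ n, p n ∣ p (n + 1)
  tendsto : Tendsto p atTop atTop

/-- The odometer group `G = lim ℤ/p_n ℤ`, a topological group as a subgroup of `∏ ℤ/p_n ℤ`
(product of discrete spaces). -/
def Odometer (P : PeriodChain) : AddSubgroup (∀ n, ZMod (P.p n)) where
  carrier := {g | ∀ n, ZMod.castHom (P.dvd_succ n) (ZMod (P.p n)) (g (n + 1)) = g n}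
  add_mem' := by
    intro a b ha hb n
    simp only [mem_ofPred_eq] at ha hb
    rw [Pi.add_apply, Pi.add_apply, map_add, ha n, hb n]
  zero_mem' := by intro n; simp
  neg_mem' := by
    intro a ha n
    simp only [mem_ofPred_eq] at ha
    rw [Pi.neg_apply, Pi.neg_apply, map_neg, ha n]

/-- The diagonal embedding `Δ : ℤ → G`. -/
def diag (P : PeriodChain) (k : ℤ) : Odometer P :=
  ⟨fun _ => k, fun n => by simp⟩

/-! ## Toeplitz sequences and their holes -/

/-- `P_n^i`: the positions `k` such that `η` equals `i` on `k + p_n ℤ`. -/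
def periodicPositions (η : ℤ → Bool) (P : PeriodChain) (n : ℕ) (i : Bool) : Set ℤ :=
  {k | ∀ j : ℤ, η (k + P.p n * j) = i}

/-- `η` is a non-periodic Toeplitz sequence with period structure `(p_n)`. -/
structure IsToeplitz (η : ℤ → Bool) (P : PeriodChain) : Prop where
  /-- every position is periodic at some level -/
  exists_level : ∀ k : ℤ, ∃ n, ∃ i, k ∈ periodicPositions η P n i
  /-- `η` is not periodic -/
  not_periodic : ¬ ∃ t : ℤ, 0 < t ∧ ∀ k, η (k + t) = η k
  /-- the `p_n` do not contain inessential factors: `p_n` divides every period of the partially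
  filled sequence ("skeleton") of some level `N`. This holds with `N = n` when every `p_n` is an
  essential period of `η`, and it is what makes `lim ℤ/p_n ℤ` a factor of `X_η`. -/
  essential : ∀ n, ∃ N, ∀ t : ℤ,
    (∀ i, ∀ k ∈ periodicPositions η P N i, k + t ∈ periodicPositions η P N i) → (P.p n : ℤ) ∣ t

/-- `H_n`: the holes at level `n`. -/
def holes (η : ℤ → Bool) (P : PeriodChain) (n : ℕ) : Set ℤ :=
  (periodicPositions η P n false ∪ periodicPositions η P n true)ᶜ

/-- The essential holes at level `N`: the `k ∈ H_N` such that `k + p_N ℤ` meets `H_n` for all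
`n ≥ N`. -/
def essentialHoles (η : ℤ → Bool) (P : PeriodChain) (N : ℕ) : Set ℤ :=
  {k | k ∈ holes η P N ∧ ∀ n, N ≤ n → ∃ j : ℤ, k + P.p N * j ∈ holes η P n}

/-- The minimal period of the set of essential holes at level `n`. -/
noncomputable def essentialPeriod (η : ℤ → Bool) (P : PeriodChain) (n : ℕ) : ℕ :=
  sInf {t : ℕ | 0 < t ∧ ∀ k : ℤ, k + t ∈ essentialHoles η P n ↔ k ∈ essentialHoles η P n}

/-! ## The window -/

/-- `V^i`: the union of the cylinder sets `U_n(Δ(k)) = {g : g_n = k}` over all `n` and all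
`k ∈ P_n^i ∩ [0, p_n)`. -/
def windowPart (η : ℤ → Bool) (P : PeriodChain) (i : Bool) : Set (Odometer P) :=
  ⋃ n : ℕ, ⋃ k ∈ periodicPositions η P n i ∩ Ico 0 (P.p n : ℤ),
    {g : Odometer P | (g : ∀ n, ZMod (P.p n)) n = (k : ZMod (P.p n))}

/-- The window `W`, the closure of `V^1`. -/
def window (η : ℤ → Bool) (P : PeriodChain) : Set (Odometer P) :=
  closure (windowPart η P true)

/-- `∂W`. -/
def windowBoundary (η : ℤ → Bool) (P : PeriodChain) : Set (Odometer P) :=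
  frontier (window η P)

/-! ## The factor map onto the odometer -/

/-- `π : (X_η, σ) → (G, T)` is continuous, equivariant, and maps `η` to `Δ(0) = 0`. -/
def IsFactorMap (η : ℤ → Bool) (P : PeriodChain) (π : orbitClosure η → Odometer P) : Prop :=
  Continuous π ∧ (∀ x, π (shift η x) = π x + diag P 1) ∧ π (base η) = 0

theorem isOpen_agree (x : ℤ → Bool) (L : ℕ) :
    IsOpen {z : ℤ → Bool | ∀ j : ℤ, |j| ≤ L → z j = x j} := by
  have h := isOpen_set_pi (s := fun j : ℤ => ({x j} : Set Bool))
    (Set.finite_Icc (-(L : ℤ)) L) (fun a _ => isOpen_discrete _)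
  convert h using 1
  ext z
  simp [Set.mem_pi, abs_le]

theorem exists_agree {η x : ℤ → Bool} (hx : x ∈ orbitClosure η) (L : ℕ) :
    ∃ k : ℤ, ∀ j : ℤ, |j| ≤ L → η (k + j) = x j := by
  obtain ⟨z, hz, ⟨k, rfl⟩⟩ := mem_closure_iff.1 hx _ (isOpen_agree x L) (fun _ _ => rfl)
  exact ⟨k, fun j hj => by rw [add_comm]; exact hz j hj⟩

theorem PeriodChain.dvd_of_le (P : PeriodChain) {m n : ℕ} (h : m ≤ n) : P.p m ∣ P.p n := by
  induction n, h using Nat.le_induction with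
  | base => exact dvd_rfl
  | succ n _ ih => exact ih.trans (P.dvd_succ n)

/-- The residue mod `p_n` of a position is determined by `η` on a window around it. -/
theorem exists_window {η : ℤ → Bool} {P : PeriodChain} (h : IsToeplitz η P) (n : ℕ) :
    ∃ L : ℕ, ∀ k k' : ℤ, (∀ j : ℤ, |j| ≤ L → η (k + j) = η (k' + j)) →
      (k : ZMod (P.p n)) = (k' : ZMod (P.p n)) := by
  obtain ⟨N, hN⟩ := h.essential n
  have hev : ∀ i : Bool, ∀ c : ℤ, ∀ᶠ M in atTop, c ∉ periodicPositions η P N i →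
      ∃ d : ℤ, ∀ j : ℤ, η (c + P.p N * d + P.p M * j) ≠ i := by
    intro i c
    by_cases hc : c ∈ periodicPositions η P N i
    · exact Eventually.of_forall fun M h' => absurd hc h'
    · have hc' := hc
      simp only [periodicPositions, mem_ofPred_eq, not_forall] at hc
      obtain ⟨d, hd⟩ := hc
      obtain ⟨M₀, i', hM₀⟩ := h.exists_level (c + P.p N * d)
      filter_upwards [eventually_ge_atTop M₀] with M hM _
      refine ⟨d, fun j => ?_⟩
      obtain ⟨q, hq⟩ := P.dvd_of_le hM
      have h0 := hM₀ 0
      have h1 := hM₀ (q * j)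
      rw [mul_zero, add_zero] at h0
      rw [hq]
      push_cast
      rw [mul_assoc, h1, ← h0]
      exact hd
  have hfin : ∀ᶠ M in atTop, ∀ i ∈ (Set.univ : Set Bool), ∀ c ∈ Ico (0 : ℤ) (P.p N),
      c ∉ periodicPositions η P N i →
      ∃ d : ℤ, ∀ j : ℤ, η (c + P.p N * d + P.p M * j) ≠ i := by
    rw [Set.finite_univ.eventually_all]
    intro i _
    rw [(Set.finite_Ico (0 : ℤ) (P.p N)).eventually_all]
    exact fun c _ => hev i c
  obtain ⟨M, hM, hNM⟩ := (hfin.and (eventually_ge_atTop N)).exists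
  have hpN : (0 : ℤ) < P.p N := by exact_mod_cast P.pos N
  have hpM : (0 : ℤ) < P.p M := by exact_mod_cast P.pos M
  obtain ⟨q, hq⟩ := P.dvd_of_le hNM
  refine ⟨P.p M, fun k k' hkk => ?_⟩
  rw [ZMod.intCast_eq_intCast_iff_dvd_sub]
  refine hN _ fun i c hc => ?_
  by_contra hcon
  -- the representative of `c + (k' - k)` in `[0, p_N)`
  set u := c + (k' - k) with hu
  have hdiv := Int.emod_add_mul_ediv u (P.p N)
  have hcon' : u % P.p N ∉ periodicPositions η P N i := by
    intro h'
    apply hcon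
    intro j
    have := h' (u / P.p N + j)
    rw [mul_add, ← add_assoc, hdiv] at this
    exact this
  obtain ⟨d, hd⟩ := hM i (mem_univ i) _
    ⟨Int.emod_nonneg _ hpN.ne', Int.emod_lt_of_pos _ hpN⟩ hcon'
  -- translate into the window around `k'`
  set w := u % P.p N + P.p N * d with hw
  have hdiv2 := Int.emod_add_mul_ediv (w - k') (P.p M)
  set e := (w - k') % P.p M with he
  have he0 : 0 ≤ e := Int.emod_nonneg _ hpM.ne'
  have he1 : e < P.p M := Int.emod_lt_of_pos _ hpM
  have hkey := hkk e (by rw [abs_of_nonneg he0]; exact he1.le)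
  have h1 := hd (-((w - k') / P.p M))
  have h2 : w + P.p M * (-((w - k') / P.p M)) = k' + e := by linarith
  rw [h2, ← hkey] at h1
  apply h1
  have h3 := hc (-(u / P.p N) + d - q * ((w - k') / P.p M))
  rw [← h3]
  congr 1
  have hq' : (P.p M : ℤ) = P.p N * q := by exact_mod_cast hq
  have e1 : e = w - k' - P.p M * ((w - k') / P.p M) := by linarith
  have e2 : u % P.p N = u - P.p N * (u / P.p N) := by linarith
  rw [e1]
  generalize (w - k') / (P.p M : ℤ) = z
  rw [hw, e2, hq', hu]
  ring

theorem exists_factorMap {η : ℤ → Bool} {P : PeriodChain} (h : IsToeplitz η P) :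
    ∃ π : orbitClosure η → Odometer P, IsFactorMap η P π := by
  choose L hL using exists_window h
  choose κ hκ using fun (x : orbitClosure η) (n : ℕ) => exists_agree x.2 (L n)
  have key : ∀ (x : orbitClosure η) (n : ℕ) (k : ℤ),
      (∀ j : ℤ, |j| ≤ L n → η (k + j) = (x : ℤ → Bool) j) →
      (k : ZMod (P.p n)) = (κ x n : ZMod (P.p n)) := fun x n k hk =>
    hL n _ _ fun j hj => (hk j hj).trans (hκ x n j hj).symm
  have compat : ∀ x : orbitClosure η,
      (fun n => (κ x n : ZMod (P.p n))) ∈ Odometer P := by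
    intro x n
    obtain ⟨k, hk⟩ := exists_agree x.2 (max (L n) (L (n + 1)))
    have h1 := key x n k fun j hj => hk j (hj.trans (by exact_mod_cast le_max_left _ _))
    have h2 := key x (n + 1) k fun j hj => hk j (hj.trans (by exact_mod_cast le_max_right _ _))
    change ZMod.castHom (P.dvd_succ n) (ZMod (P.p n)) (κ x (n + 1) : ZMod (P.p (n + 1))) =
      (κ x n : ZMod (P.p n))
    rw [← h2, ← h1]
    simp
  refine ⟨fun x => ⟨fun n => (κ x n : ZMod (P.p n)), compat x⟩, ?_, ?_, ?_⟩
  · refine Continuous.subtype_mk (continuous_pi fun n => ?_) _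
    refine (IsLocallyConstant.iff_exists_open _).2 (fun x => ?_) |>.continuous
    refine ⟨Subtype.val ⁻¹' {z : ℤ → Bool | ∀ j : ℤ, |j| ≤ L n → z j = (x : ℤ → Bool) j},
      (isOpen_agree _ _).preimage continuous_subtype_val, fun _ _ => rfl, fun x' hx' => ?_⟩
    exact key x n _ fun j hj => (hκ x' n j hj).trans (hx' j hj)
  · intro x
    apply Subtype.ext
    funext n
    obtain ⟨k, hk⟩ := exists_agree x.2 (L n + 1)
    have h1 := key x n k fun j hj => hk j (by push_cast; linarith)
    have h2 := key (shift η x) n (k + 1) fun j hj => by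
      have := hk (j + 1) (by
        push_cast
        exact (abs_add_le j 1).trans (by simpa using hj))
      rw [add_assoc, add_comm 1 j]
      exact this
    change (κ (shift η x) n : ZMod (P.p n)) = (κ x n : ZMod (P.p n)) + ((1 : ℤ) : ZMod (P.p n))
    rw [← h2, ← h1]
    push_cast
    rfl
  · apply Subtype.ext
    funext n
    have := key (base η) n 0 fun j _ => by rw [zero_add]; rfl
    change (κ (base η) n : ZMod (P.p n)) = 0
    rw [← this]
    simp

theorem factorMap_unique {η : ℤ → Bool} {P : PeriodChain} {π π' : orbitClosure η → Odometer P}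
    (hπ : IsFactorMap η P π) (hπ' : IsFactorMap η P π') : π = π' := by
  obtain ⟨hc, he, hb⟩ := hπ
  obtain ⟨hc', he', hb'⟩ := hπ'
  have hmem : ∀ k : ℤ, (fun i : ℤ => η (i + k)) ∈ orbitClosure η := fun k =>
    subset_closure ⟨k, rfl⟩
  have hstep : ∀ k : ℤ, shift η ⟨_, hmem k⟩ = ⟨_, hmem (k + 1)⟩ := by
    intro k
    apply Subtype.ext
    funext i
    change η (i + 1 + k) = η (i + (k + 1))
    congr 1
    ring
  have horb : ∀ k : ℤ, π ⟨_, hmem k⟩ = π' ⟨_, hmem k⟩ := by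
    intro k
    induction k using Int.induction_on with
    | zero =>
      have : (⟨_, hmem 0⟩ : orbitClosure η) = base η := by
        apply Subtype.ext
        funext i
        change η (i + 0) = η i
        rw [add_zero]
      rw [this, hb, hb']
    | succ k ih => rw [← hstep, he, he', ih]
    | pred k ih =>
      have hs := hstep (-(k : ℤ) - 1)
      have e1 := he ⟨_, hmem (-(k : ℤ) - 1)⟩
      have e2 := he' ⟨_, hmem (-(k : ℤ) - 1)⟩
      have hz : (⟨_, hmem (-(k : ℤ) - 1 + 1)⟩ : orbitClosure η) = ⟨_, hmem (-(k : ℤ))⟩ := by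
        apply Subtype.ext
        funext i
        change η (i + (-(k : ℤ) - 1 + 1)) = η (i + -(k : ℤ))
        congr 1
        ring
      rw [hs, hz] at e1 e2
      rw [e1, e2] at ih
      exact add_right_cancel ih
  have hdense : Dense (range fun k : ℤ => (⟨_, hmem k⟩ : orbitClosure η)) := by
    intro x
    rw [closure_subtype]
    have hx := x.2
    unfold orbitClosure at hx
    convert hx using 2
    rw [← range_comp]
    rfl
  exact Continuous.ext_on hdense hc hc' (by rintro _ ⟨k, rfl⟩; exact horb k)

/-- The factor map `π` from `X_η` onto its maximal equicontinuous factor `G`, normalized by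
`π(η) = Δ(0)`; it is unique by `factorMap_unique`. -/
noncomputable def factorMap {η : ℤ → Bool} {P : PeriodChain} (h : IsToeplitz η P) :
    orbitClosure η → Odometer P :=
  (exists_factorMap h).choose

theorem factorMap_spec {η : ℤ → Bool} {P : PeriodChain} (h : IsToeplitz η P) :
    IsFactorMap η P (factorMap h) :=
  (exists_factorMap h).choose_spec

/-- `y_F = π(F(η))`, the element of `G` with `π(F(x)) = π(x) + y_F` for all `x ∈ X_η`. -/
noncomputable def translation {η : ℤ → Bool} {P : PeriodChain} (h : IsToeplitz η P)
    (F : orbitClosure η ≃ₜ orbitClosure η) : Odometer P :=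
  factorMap h (F (base η))

/-- The class `(y_F)_n - k` in `ℤ/p_n ℤ`. Divisibility of it by an integer `a` means membership
in `a (ℤ/p_n ℤ)`, which is divisibility in the ring `ZMod (p_n)`. -/
noncomputable def offset {η : ℤ → Bool} {P : PeriodChain} (h : IsToeplitz η P)
    (F : orbitClosure η ≃ₜ orbitClosure η) (n : ℕ) (k : ℤ) : ZMod (P.p n) :=
  (translation h F : ∀ n, ZMod (P.p n)) n - (k : ZMod (P.p n))

/-- `V_k = ∂W ∩ (∂W + Δ(k) - y_F)`. -/
def overlap {η : ℤ → Bool} {P : PeriodChain} (h : IsToeplitz η P)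
    (F : orbitClosure η ≃ₜ orbitClosure η) (k : ℤ) : Set (Odometer P) :=
  {g | g ∈ windowBoundary η P ∧ ∃ b ∈ windowBoundary η P, g = b + diag P k - translation h F}

/-- `K`: the integers `k` for which `V_k` has non-empty interior relative to `∂W`. -/
def shiftSet {η : ℤ → Bool} {P : PeriodChain} (h : IsToeplitz η P)
    (F : orbitClosure η ≃ₜ orbitClosure η) : Set ℤ :=
  {k | (interior {g : windowBoundary η P | (g : Odometer P) ∈ overlap h F k}).Nonempty}

/-! ## Arithmetic structure of the essential holes -/

/-- The set of multiples `M_B = ⋃_{b ∈ B} b ℤ`. -/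
def multiples (B : Set ℕ) : Set ℤ :=
  {x | ∃ b ∈ B, (b : ℤ) ∣ x}

/-- Every set of essential holes is `⋃_{a ∈ A_n} (a ℤ ∖ M_{S_n(a)})` with non-empty pieces, where
`A_n` is a primitive set of positive integers and the `S_n(a)` are sets of positive integers. -/
structure HasArithmeticStructure (η : ℤ → Bool) (P : PeriodChain) (A : ℕ → Set ℕ)
    (S : ℕ → ℕ → Set ℕ) : Prop where
  pos : ∀ n, ∀ a ∈ A n, 0 < a
  primitive : ∀ n, ∀ a ∈ A n, ∀ a' ∈ A n, a' ∣ a → a' = a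
  pos_S : ∀ n, ∀ a ∈ A n, ∀ s ∈ S n a, 0 < s
  essentialHoles_eq : ∀ n, essentialHoles η P n = ⋃ a ∈ A n, multiples {a} \ multiples (S n a)
  nonempty : ∀ n, ∀ a ∈ A n, (multiples {a} \ multiples (S n a)).Nonempty

/-- `lim_n ∑_{a' ∈ A_n ∖ {a_n}} 1 / φ(a' / gcd(a', a_n)) = 0` for all choices of `a_n ∈ A_n`.
The sums have values in `[0, ∞]`. -/
def SummabilityCondition (A : ℕ → Set ℕ) : Prop :=
  ∀ a : ℕ → ℕ, (∀ n, a n ∈ A n) →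
    Tendsto (fun n => ∑' a' : ↥(A n \ {a n}),
      ((Nat.totient ((a' : ℕ) / Nat.gcd a' (a n)) : ℝ≥0∞))⁻¹) atTop (𝓝 0)

/-- The graph with vertex set `A` and an edge between distinct `a, a'` with `gcd(a, a') > c`. -/
def gcdGraph (A : Set ℕ) (c : ℕ) : SimpleGraph A :=
  SimpleGraph.fromRel fun a a' => c < Nat.gcd a a'

end ToeplitzShift

open ToeplitzShift

/-! The link between arithmetic and topology is `IsToeplitz.mem_essentialHoles_iff`: the essential
holes at level `n` are exactly the residues mod `p_n` of points of `∂W`. Two points of one fibre of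
`π` can differ only at times when the odometer orbit visits `∂W`, and over a point of `∂W` both
symbols occur at `0`. Since `F` acts on `G` as translation by `y_F`, it follows that every point of
`∂W + y_F` has an integer translate in `∂W`. By Baire, on some relatively open piece of any open
part of `∂W` a single `k` works: `g ↦ g + y_F - Δ(k)` maps that piece into `∂W`
(`exists_level_shiftSet`), so `k ∈ K`.

The decisive step is `eventually_dvd_of_translate`: if translation by `z` maps a cylinder of `∂W`
into `∂W`, then for large `n` the elements `a ∈ A_n` seen in this cylinder divide `z_n`. Otherwise
take `a ∤ z_n`. The essential holes contain many multiples `a l t` with `t` coprime to `p_n`, and by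
the summability condition a sieve finds `t` for which `a l t + z_n` is divisible by no element of
`A_n`; this number is then not an essential hole, contradicting the inclusion. The sieve needs `a ∣
p_n` and invariance of the essential holes under multiplication by units mod `p_n`; both follow from
periodicity and primitivity by an argument with Dirichlet's theorem
(`IsPrimitivelyCovered.mem_of_mul_coprime_mem`).

Applied to `z = y_F - Δ(k)` this gives a) and the existence in b). Applied to `z = Δ(l)` it forces
`l = 0`, whence `|k| ≤ m` on `K` (`abs_le_of_mem_shiftSet`); so two elements of `K` congruent modulo
a number above `2m` coincide, which gives uniqueness in b), and c). If `K = {k}`, the translation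
preserves all of `∂W`, hence `(y_F)_n - k` is a period of the essential holes; this is d), and e)
follows because the fibre over `Δ(k)` is a single point. -/

namespace ToeplitzShift

/-! ### Periodic sets covered by multiples of a primitive set -/

/-- A `p`-periodic set of integers such that every element `x` is a multiple of some `a ∈ A` with
all intermediate divisors in the set, where `A` is a primitive subset of the set. -/
structure IsPrimitivelyCovered (H : Set ℤ) (p : ℕ) (A : Set ℕ) : Prop where
  pos : ∀ a ∈ A, 0 < a
  primitive : ∀ a ∈ A, ∀ a' ∈ A, a' ∣ a → a' = a
  mem : ∀ a ∈ A, (a : ℤ) ∈ H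
  cover : ∀ x ∈ H, ∃ a ∈ A, (a : ℤ) ∣ x ∧ ∀ y : ℤ, (a : ℤ) ∣ y → y ∣ x → y ∈ H
  periodic : ∀ x y : ℤ, (x : ZMod p) = (y : ZMod p) → x ∈ H → y ∈ H

/-- Every integer is congruent mod `p` to its gcd with `p` times a number coprime to `p`. -/
theorem exists_coprime_mul_gcd (p : ℕ) (hp : 0 < p) (x : ℤ) :
    ∃ q : ℕ, q.Coprime p ∧ ((Int.gcd x p * q : ℤ) : ZMod p) = (x : ZMod p) := by
  have : NeZero p := ⟨hp.ne'⟩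
  set d := Int.gcd x p with hd
  have hdp : d ∣ p := by
    have := Int.gcd_dvd_right x (p : ℤ)
    exact_mod_cast this
  have hd0 : 0 < d := Nat.pos_of_dvd_of_pos hdp hp
  obtain ⟨e, he⟩ := hdp
  have he0 : 0 < e := by
    rcases Nat.eq_zero_or_pos e with h | h
    · subst h; omega
    · exact h
  have : NeZero e := ⟨he0.ne'⟩
  obtain ⟨w, hw⟩ : (d : ℤ) ∣ x := Int.gcd_dvd_left x (p : ℤ)
  have hcop : IsCoprime w (e : ℤ) := by
    rw [Int.isCoprime_iff_gcd_eq_one]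
    have h1 : Int.gcd x p = d * Int.gcd w e := by
      rw [hw, he]
      push_cast
      rw [Int.gcd_mul_left]
      simp
    have h2 : d * Int.gcd w e = d * 1 := by rw [← h1, ← hd, mul_one]
    exact Nat.eq_of_mul_eq_mul_left hd0 h2
  have hunit : IsUnit (w : ZMod e) := by
    obtain ⟨a, b, hab⟩ := hcop
    have h1 : ((a * w + b * e : ℤ) : ZMod e) = 1 := by rw [hab]; simp
    push_cast at h1
    rw [ZMod.natCast_self, mul_zero, add_zero] at h1
    exact IsUnit.of_mul_eq_one_right _ h1
  have hep : e ∣ p := ⟨d, by rw [he, mul_comm]⟩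
  -- `w = x / d` is a unit only modulo `e = p / d`. Lifting it to a unit mod `p` changes it by a
  -- multiple of `e`, which becomes a multiple of `p` after multiplication by `d`.
  obtain ⟨u, hu⟩ := ZMod.unitsMap_surjective hep hunit.unit
  refine ⟨(u : ZMod p).val, ZMod.val_coe_unit_coprime u, ?_⟩
  have h1 : (((u : ZMod p).val : ℤ) : ZMod e) = (w : ZMod e) := by
    have h2 := congrArg (fun z : (ZMod e)ˣ => (z : ZMod e)) hu
    simp only [ZMod.unitsMap_def, Units.coe_map, IsUnit.unit_spec] at h2
    rw [← h2]
    rw [Int.cast_natCast]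
    exact (ZMod.cast_eq_val _).symm
  rw [ZMod.intCast_eq_intCast_iff_dvd_sub] at h1 ⊢
  obtain ⟨c, hc⟩ := h1
  refine ⟨c, ?_⟩
  have hpe : (p : ℤ) = d * e := by exact_mod_cast he
  rw [hw, hpe]
  linear_combination (d : ℤ) * hc

namespace IsPrimitivelyCovered

variable {H : Set ℤ} {p : ℕ} {A : Set ℕ}

/-- Analysis of a minimal counterexample `d` to `mem_of_mul_coprime_mem`. Let `a ∈ A` cover `d * Q`.
If `gcd a d < d`, minimality puts `gcd a d` in `H`, so some `b ∈ A` divides it; primitivity gives `b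
= a`, so `a ∣ d ∣ d * Q` and the chain condition yields `d ∈ H`. Hence `d ∣ a`. -/
theorem exists_mul_mem (hH : IsPrimitivelyCovered H p A) {d : ℕ} (hdH : (d : ℤ) ∉ H)
    (hd : ∀ d' < d, d' ∣ d → ∀ q : ℕ, q.Coprime p → ((d' * q : ℕ) : ℤ) ∈ H → (d' : ℤ) ∈ H)
    {Q : ℕ} (hQ : Q.Coprime p) (hQH : ((d * Q : ℕ) : ℤ) ∈ H) (hd0 : 0 < d) :
    ∃ Q', Q' ∣ Q ∧ d * Q' ∈ A ∧ ∀ Y, Q' ∣ Y → Y ∣ Q → ((d * Y : ℕ) : ℤ) ∈ H := by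
  obtain ⟨a, haA, hadvd, hchain⟩ := hH.cover _ hQH
  have hadvd' : a ∣ d * Q := by exact_mod_cast hadvd
  have ha0 := hH.pos a haA
  have hg0 : 0 < Nat.gcd a d := Nat.gcd_pos_of_pos_left _ ha0
  obtain ⟨Q', hQ'⟩ : Nat.gcd a d ∣ a := Nat.gcd_dvd_left a d
  have hcop : Nat.Coprime Q' (d / Nat.gcd a d) := by
    have h1 := Nat.coprime_div_gcd_div_gcd hg0
    rwa [Nat.div_eq_of_eq_mul_right hg0 hQ'] at h1
  have hQQ : Q' ∣ Q := by
    obtain ⟨e, he⟩ : Nat.gcd a d ∣ d := Nat.gcd_dvd_right a d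
    rw [Nat.div_eq_of_eq_mul_right hg0 he] at hcop
    have h1 : Nat.gcd a d * Q' ∣ Nat.gcd a d * (e * Q) := by
      rw [← hQ', ← mul_assoc, ← he]; exact hadvd'
    exact hcop.dvd_of_dvd_mul_left (Nat.dvd_of_mul_dvd_mul_left hg0 h1)
  have hgd : Nat.gcd a d = d := by
    by_contra hne
    have hlt : Nat.gcd a d < d :=
      lt_of_le_of_ne (Nat.le_of_dvd hd0 (Nat.gcd_dvd_right a d)) hne
    have h1 := hd _ hlt (Nat.gcd_dvd_right a d) Q' (hQ.coprime_dvd_left hQQ)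
      (by rw [← hQ']; exact hH.mem a haA)
    obtain ⟨b, hbA, hb, -⟩ := hH.cover _ h1
    have hb' : b ∣ Nat.gcd a d := by exact_mod_cast hb
    have hba := hH.primitive a haA b hbA (hb'.trans (Nat.gcd_dvd_left a d))
    rw [hba] at hb'
    apply hdH
    apply hchain
    · exact_mod_cast hb'.trans (Nat.gcd_dvd_right a d)
    · exact_mod_cast dvd_mul_right d Q
  rw [hgd] at hQ'
  refine ⟨Q', hQQ, hQ' ▸ haA, fun Y h1 h2 => hchain _ ?_ ?_⟩
  · rw [hQ']; exact_mod_cast mul_dvd_mul_left d h1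
  · exact_mod_cast mul_dvd_mul_left d h2

/-- If `d` is a minimal counterexample, `exists_mul_mem` puts `d * r` in `A` for every prime `r ≡ q`
mod `p`, and by Dirichlet there are infinitely many. The same lemma for a suitable product of such
primes contradicts either primitivity or `d ∉ H`. -/
theorem mem_of_mul_coprime_mem (hH : IsPrimitivelyCovered H p A) (hp : 0 < p) (d : ℕ) (hdp : d ∣ p)
    (q : ℕ) (hq : q.Coprime p) (hdq : ((d * q : ℕ) : ℤ) ∈ H) : (d : ℤ) ∈ H := by
  have : NeZero p := ⟨hp.ne'⟩
  induction d using Nat.strong_induction_on generalizing q with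
  | _ d ih =>
    by_contra hdH
    have hd0 : 0 < d := Nat.pos_of_dvd_of_pos hdp hp
    have key : ∀ Q : ℕ, (Q : ZMod p) = (q : ZMod p) →
        ∃ Q', Q' ∣ Q ∧ d * Q' ∈ A ∧ ∀ Y, Q' ∣ Y → Y ∣ Q → ((d * Y : ℕ) : ℤ) ∈ H := by
      intro Q hQ
      refine hH.exists_mul_mem hdH (fun d' h1 h2 q' h3 h4 => ih d' h1 (h2.trans hdp) q' h3 h4)
        ?_ ?_ hd0
      · rw [← ZMod.isUnit_iff_coprime, hQ]
        exact (ZMod.isUnit_iff_coprime q p).2 hq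
      · refine hH.periodic _ _ ?_ hdq
        push_cast
        rw [hQ]
    have hprime : ∀ r : ℕ, r.Prime → (r : ZMod p) = q → d * r ∈ A := by
      intro r hr hrq
      obtain ⟨Q', h1, h2, -⟩ := key r hrq
      rcases (Nat.dvd_prime hr).1 h1 with h | h
      · rw [h, mul_one] at h2
        exact absurd (hH.mem d h2) hdH
      · rwa [h] at h2
    have hinf := Nat.infinite_setOfPred_prime_and_eq_mod
      (a := (q : ZMod p)) ((ZMod.isUnit_iff_coprime q p).2 hq)
    -- With `φ(p) + 1` primes the full product is `≡ q`, so `key` applies to it, while omitting one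
    -- prime leaves a product `≡ 1`, so `d` times it is `≡ d`.
    obtain ⟨s, hs, hcard⟩ := hinf.exists_subset_card_eq (p.totient + 1)
    have hsP : ∀ r ∈ s, r.Prime ∧ (r : ZMod p) = q := fun r hr => hs hr
    have htot : (q : ZMod p) ^ p.totient = 1 := by
      have := Nat.ModEq.pow_totient hq
      rw [← ZMod.natCast_eq_natCast_iff] at this
      simpa using this
    have hprod : ∀ t ⊆ s, ((∏ r ∈ t, r : ℕ) : ZMod p) = (q : ZMod p) ^ t.card := by
      intro t ht
      rw [Nat.cast_prod]
      exact Finset.prod_eq_pow_card fun r hr => (hsP r (ht hr)).2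
    obtain ⟨Q', h1, h2, h3⟩ := key (∏ r ∈ s, r) (by
      rw [hprod s subset_rfl, hcard, pow_succ, htot, one_mul])
    by_cases hall : ∀ r ∈ s, r ∣ Q'
    · have hsQ : ∏ r ∈ s, r ∣ Q' :=
        Finset.prod_primes_dvd _ (fun r hr => (hsP r hr).1.prime) hall
      have htp : 0 < p.totient := Nat.totient_pos.2 hp
      obtain ⟨r, hr, r', hr', hne⟩ := Finset.one_lt_card.1 (show 1 < s.card by omega)
      have e : ∀ r ∈ s, d * r = d * Q' := fun r hr =>
        hH.primitive _ h2 _ (hprime r (hsP r hr).1 (hsP r hr).2) (mul_dvd_mul_left d (hall r hr))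
      exact hne (Nat.eq_of_mul_eq_mul_left hd0 ((e r hr).trans (e r' hr').symm))
    · push Not at hall
      obtain ⟨r, hr, hrQ⟩ := hall
      have hQ'0 : Q' ∣ ∏ i ∈ s.erase r, i := by
        rw [← Finset.mul_prod_erase s (fun i => i) hr] at h1
        exact (((hsP r hr).1.coprime_iff_not_dvd.2 hrQ).symm).dvd_of_dvd_mul_left h1
      have h4 := h3 _ hQ'0 (Finset.prod_dvd_prod_of_subset _ _ _ (Finset.erase_subset r s))
      apply hdH
      refine hH.periodic _ _ ?_ h4
      have h5 := hprod (s.erase r) (Finset.erase_subset r s)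
      rw [Finset.card_erase_of_mem hr, hcard, Nat.add_sub_cancel, htot] at h5
      rw [Int.cast_natCast, Int.cast_natCast, Nat.cast_mul, h5, mul_one]

theorem gcd_mem (hH : IsPrimitivelyCovered H p A) (hp : 0 < p) {x : ℤ} (hx : x ∈ H) :
    (Int.gcd x p : ℤ) ∈ H := by
  obtain ⟨q, hq, hqx⟩ := exists_coprime_mul_gcd p hp x
  refine hH.mem_of_mul_coprime_mem hp _ ?_ q hq ?_
  · exact_mod_cast Int.gcd_dvd_right x (p : ℤ)
  · exact hH.periodic _ _ (by rw [← hqx]; push_cast; rfl) hx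

/-- An element of `A` below `gcd a p ∈ H` divides `a`, so it equals `a`. -/
theorem dvd_period (hH : IsPrimitivelyCovered H p A) (hp : 0 < p) {a : ℕ} (ha : a ∈ A) :
    a ∣ p := by
  obtain ⟨b, hb, hba, -⟩ := hH.cover _ (hH.gcd_mem hp (hH.mem a ha))
  have h1 : b ∣ Nat.gcd a p := by exact_mod_cast hba
  have h2 := hH.primitive a ha b hb (h1.trans (Nat.gcd_dvd_left _ _))
  exact h2 ▸ h1.trans (Nat.gcd_dvd_right _ _)

theorem finite (hH : IsPrimitivelyCovered H p A) (hp : 0 < p) : A.Finite :=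
  (Set.finite_Iic p).subset fun _ ha => Nat.le_of_dvd hp (hH.dvd_period hp ha)

theorem exists_dvd (hH : IsPrimitivelyCovered H p A) {x : ℤ} (hx : x ∈ H) :
    ∃ a ∈ A, (a : ℤ) ∣ x :=
  let ⟨a, ha, h, _⟩ := hH.cover x hx
  ⟨a, ha, h⟩

/-- With `x ≡ g q`, `g = gcd x p`, and `u` inverse to `q t`, the number `g q t u ≡ g` lies in `H`.
The `a ∈ A` covering it divides `p`, hence is coprime to `u`, so `g q t ≡ x t` lies between `a` and
it in the divisor order. -/
theorem mul_mem_of_coprime (hH : IsPrimitivelyCovered H p A) (hp : 0 < p) {x : ℤ} (hx : x ∈ H)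
    {t : ℕ} (ht : t.Coprime p) : x * t ∈ H := by
  have : NeZero p := ⟨hp.ne'⟩
  obtain ⟨q, hq, hqx⟩ := exists_coprime_mul_gcd p hp x
  have hqt : (q * t).Coprime p := hq.mul_left ht
  set u := ((ZMod.unitOfCoprime (q * t) hqt)⁻¹ : (ZMod p)ˣ)
  have hu : ((u : ZMod p).val : ZMod p) * ((q * t : ℕ) : ZMod p) = 1 := by
    rw [ZMod.natCast_zmod_val]
    have := Units.inv_mul (ZMod.unitOfCoprime (q * t) hqt)
    rwa [ZMod.coe_unitOfCoprime] at this
  have h1 : (Int.gcd x p : ℤ) * (q * t) * (u : ZMod p).val ∈ H := by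
    refine hH.periodic _ _ ?_ (hH.gcd_mem hp hx)
    push_cast at hu ⊢
    linear_combination (-(Int.gcd x p : ZMod p)) * hu
  obtain ⟨a, ha, hdvd, hchain⟩ := hH.cover _ h1
  have hap := hH.dvd_period hp ha
  have hcop : IsCoprime (a : ℤ) ((u : ZMod p).val : ℤ) := by
    rw [Nat.isCoprime_iff_coprime]
    exact ((ZMod.val_coe_unit_coprime u).coprime_dvd_right hap).symm
  have h2 := hchain _ (hcop.dvd_of_dvd_mul_right hdvd) (dvd_mul_right _ _)
  refine hH.periodic _ _ ?_ h2
  push_cast at hqx ⊢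
  rw [← hqx]
  ring

end IsPrimitivelyCovered

/-! ### Counting units and the sieve -/

theorem totient_mul_le (a b : ℕ) (hb : 0 < b) : (a * b).totient ≤ a.totient * b ^ 2 := by
  have h := Nat.totient_gcd_mul_totient_mul a b
  have hg : 0 < Nat.gcd a b := Nat.gcd_pos_of_pos_right _ hb
  have h1 : 0 < (Nat.gcd a b).totient := Nat.totient_pos.2 hg
  calc (a * b).totient ≤ (Nat.gcd a b).totient * (a * b).totient := Nat.le_mul_of_pos_left _ h1
    _ = a.totient * (b.totient * Nat.gcd a b) := by rw [h, mul_assoc]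
    _ ≤ a.totient * (b * b) :=
      Nat.mul_le_mul_left _ (Nat.mul_le_mul (Nat.totient_le b) (Nat.gcd_le_right _ hb))
    _ = _ := by rw [sq]

theorem card_fiber_unitsMap {c p : ℕ} [NeZero p] (hc : c ∣ p) (v : (ZMod c)ˣ) :
    (Finset.univ.filter fun u : (ZMod p)ˣ => ZMod.unitsMap hc u = v).card * c.totient =
      p.totient := by
  have : NeZero c := ⟨(Nat.pos_of_dvd_of_pos hc (NeZero.pos p)).ne'⟩
  have hs := ZMod.unitsMap_surjective hc
  have h := Finset.card_eq_sum_card_fiberwise (f := ZMod.unitsMap hc)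
    (s := (Finset.univ : Finset (ZMod p)ˣ)) (t := Finset.univ) (fun _ _ => Finset.mem_univ _)
  have h2 : ∀ w ∈ (Finset.univ : Finset (ZMod c)ˣ),
      (Finset.univ.filter fun u : (ZMod p)ˣ => ZMod.unitsMap hc u = w).card =
      (Finset.univ.filter fun u : (ZMod p)ˣ => ZMod.unitsMap hc u = v).card := fun w _ =>
    MonoidHom.card_fiber_eq_of_mem_range _ (hs w) (hs v)
  rw [Finset.sum_congr rfl h2, Finset.sum_const, Finset.card_univ, Finset.card_univ,
    ZMod.card_units_eq_totient, ZMod.card_units_eq_totient, smul_eq_mul] at h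
  rw [h, mul_comm]

/-- The number of units `t` mod `p` with `b ∣ h t + r` is at most `φ(p) / φ(b / gcd(b, h))`. -/
theorem card_units_dvd_le {p b : ℕ} [NeZero p] (hb : b ∣ p) (h : ℕ) (r : ℤ) :
    (Finset.univ.filter fun u : (ZMod p)ˣ => (b : ℤ) ∣ h * (u : ZMod p).val + r).card *
      (b / Nat.gcd b h).totient ≤ p.totient := by
  have hb0 : 0 < b := Nat.pos_of_dvd_of_pos hb (NeZero.pos p)
  have hg0 : 0 < Nat.gcd b h := Nat.gcd_pos_of_pos_left _ hb0
  set c := b / Nat.gcd b h with hc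
  have hbc : b = Nat.gcd b h * c := (Nat.mul_div_cancel' (Nat.gcd_dvd_left b h)).symm
  have hcp : c ∣ p := (Nat.div_dvd_of_dvd (Nat.gcd_dvd_left b h)).trans hb
  have : NeZero c := ⟨(Nat.pos_of_dvd_of_pos hcp (NeZero.pos p)).ne'⟩
  rcases Finset.eq_empty_or_nonempty
    (Finset.univ.filter fun u : (ZMod p)ˣ => (b : ℤ) ∣ h * (u : ZMod p).val + r) with he | ⟨v, hv⟩
  · rw [he]; simp
  -- Two solutions differ by a multiple of `c = b / gcd b h`, so all solutions lie in one fibre of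
  -- reduction mod `c`.
  rw [← card_fiber_unitsMap hcp (ZMod.unitsMap hcp v)]
  refine Nat.mul_le_mul_right _ (Finset.card_le_card fun u hu => ?_)
  simp only [Finset.mem_filter, Finset.mem_univ, true_and] at hu hv ⊢
  have h1 : (b : ℤ) ∣ h * ((u : ZMod p).val - (v : ZMod p).val) := by
    rw [mul_sub, ← add_sub_add_right_eq_sub _ _ r]
    exact dvd_sub hu hv
  have hcop : IsCoprime (c : ℤ) ((h / Nat.gcd b h : ℕ) : ℤ) := by
    rw [Nat.isCoprime_iff_coprime]
    exact Nat.coprime_div_gcd_div_gcd hg0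
  have h2 : (c : ℤ) ∣ (u : ZMod p).val - (v : ZMod p).val := by
    refine hcop.dvd_of_dvd_mul_left ?_
    have e : (h : ℤ) = Nat.gcd b h * (h / Nat.gcd b h : ℕ) := by
      exact_mod_cast (Nat.mul_div_cancel' (Nat.gcd_dvd_right b h)).symm
    have e' : (b : ℤ) = Nat.gcd b h * c := by exact_mod_cast hbc
    rw [e, mul_assoc] at h1
    nth_rw 1 [e'] at h1
    exact Int.dvd_of_mul_dvd_mul_left (by exact_mod_cast hg0.ne') h1
  have h3 : (((v : ZMod p).val : ℤ) : ZMod c) = (((u : ZMod p).val : ℤ) : ZMod c) := by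
    rw [ZMod.intCast_eq_intCast_iff_dvd_sub]
    exact h2
  apply Units.ext
  rw [ZMod.unitsMap_val, ZMod.unitsMap_val, ZMod.cast_eq_val, ZMod.cast_eq_val]
  exact_mod_cast h3.symm

/-- A sieve: if the sum over `A ∖ {a}` is small, some `t` in a prescribed unit class mod `M` makes
`a l t + r` divisible by no element of `A`. -/
theorem exists_coprime_forall_not_dvd {p M : ℕ} (hp : 0 < p) (hM : M ∣ p) (A : Finset ℕ)
    (hA : ∀ b ∈ A, b ∣ p) (a l u : ℕ) (hl : l ∣ M) (hu : u.Coprime M) (r : ℤ)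
    (har : ¬ (a : ℤ) ∣ r)
    (hsum : (M : ℝ) ^ 3 * ∑ b ∈ A.erase a, ((b / Nat.gcd b a).totient : ℝ)⁻¹ < 1) :
    ∃ t : ℕ, t.Coprime p ∧ (t : ZMod M) = (u : ZMod M) ∧
      ∀ b ∈ A, ¬ (b : ℤ) ∣ (a * l : ℕ) * t + r := by
  classical
  have : NeZero p := ⟨hp.ne'⟩
  have hM0 : 0 < M := Nat.pos_of_dvd_of_pos hM hp
  have : NeZero M := ⟨hM0.ne'⟩
  have hl0 : 0 < l := Nat.pos_of_dvd_of_pos hl hM0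
  by_contra hcon
  push Not at hcon
  -- If no `t` works, the class `T` of size `φ(p) / φ(M)` is covered by the sets `B b`.
  set T := Finset.univ.filter fun x : (ZMod p)ˣ => ZMod.unitsMap hM x = ZMod.unitOfCoprime u hu
    with hT
  set B : ℕ → Finset (ZMod p)ˣ := fun b =>
    Finset.univ.filter fun x : (ZMod p)ˣ => (b : ℤ) ∣ (a * l : ℕ) * (x : ZMod p).val + r with hB
  have hTB : T ⊆ (A.erase a).biUnion B := by
    intro x hx
    simp only [hT, Finset.mem_filter, Finset.mem_univ, true_and] at hx
    obtain ⟨b, hbA, hb⟩ := hcon (x : ZMod p).val (ZMod.val_coe_unit_coprime x) (by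
      have h2 := congrArg (fun z : (ZMod M)ˣ => (z : ZMod M)) hx
      simp only [ZMod.unitsMap_val, ZMod.coe_unitOfCoprime] at h2
      rw [← h2, ZMod.cast_eq_val])
    refine Finset.mem_biUnion.2 ⟨b, Finset.mem_erase.2 ⟨?_, hbA⟩, by simpa [hB] using hb⟩
    -- The index `b = a` never occurs: `a` divides `a l t` but not `r`.
    rintro rfl
    apply har
    have h3 : (b : ℤ) ∣ (b * l : ℕ) * (x : ZMod p).val := by
      push_cast
      rw [mul_assoc]
      exact dvd_mul_right _ _
    exact (dvd_add_right h3).1 hb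
  have hBle : ∀ b ∈ A.erase a, ((B b).card : ℝ) ≤
      p.totient * (M ^ 2 * ((b / Nat.gcd b a).totient : ℝ)⁻¹) := by
    intro b hb
    have hbp := hA b (Finset.mem_of_mem_erase hb)
    have hb0 : 0 < b := Nat.pos_of_dvd_of_pos hbp hp
    have h1 := card_units_dvd_le hbp (a * l) r
    have hg : Nat.gcd b (a * l) ∣ Nat.gcd b a * l :=
      (Nat.gcd_mul_right_dvd_mul_gcd b a l).trans (mul_dvd_mul_left _ (Nat.gcd_dvd_right _ _))
    have hg0 : 0 < Nat.gcd b a := Nat.gcd_pos_of_pos_left _ hb0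
    have hdiv : b / Nat.gcd b a ∣ b / Nat.gcd b (a * l) * l := by
      apply Nat.dvd_of_mul_dvd_mul_left hg0
      rw [Nat.mul_div_cancel' (Nat.gcd_dvd_left b a)]
      calc b = Nat.gcd b (a * l) * (b / Nat.gcd b (a * l)) :=
            (Nat.mul_div_cancel' (Nat.gcd_dvd_left _ _)).symm
        _ ∣ Nat.gcd b a * l * (b / Nat.gcd b (a * l)) := mul_dvd_mul_right hg _
        _ = _ := by ring
    have hc0 : 0 < b / Nat.gcd b (a * l) :=
      Nat.div_pos (Nat.le_of_dvd hb0 (Nat.gcd_dvd_left _ _)) (Nat.gcd_pos_of_pos_left _ hb0)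
    have h2 : (b / Nat.gcd b a).totient ≤ (b / Nat.gcd b (a * l)).totient * M ^ 2 :=
      (Nat.le_of_dvd (Nat.totient_pos.2 (Nat.mul_pos hc0 hl0)) (Nat.totient_dvd_of_dvd hdiv)).trans
        ((totient_mul_le _ _ hl0).trans
          (Nat.mul_le_mul_left _ (Nat.pow_le_pow_left (Nat.le_of_dvd hM0 hl) 2)))
    have hφ : (0 : ℝ) < (b / Nat.gcd b a).totient := by
      exact_mod_cast Nat.totient_pos.2
        (Nat.div_pos (Nat.le_of_dvd hb0 (Nat.gcd_dvd_left _ _)) hg0)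
    rw [← mul_assoc, ← div_eq_mul_inv, le_div_iff₀ hφ]
    have h3 : (B b).card * (b / Nat.gcd b a).totient ≤ p.totient * M ^ 2 := by
      calc (B b).card * (b / Nat.gcd b a).totient
          ≤ (B b).card * ((b / Nat.gcd b (a * l)).totient * M ^ 2) := Nat.mul_le_mul_left _ h2
        _ = ((B b).card * (b / Nat.gcd b (a * l)).totient) * M ^ 2 := by rw [mul_assoc]
        _ ≤ _ := Nat.mul_le_mul_right _ h1
    exact_mod_cast h3
  have hTc : T.card * M.totient = p.totient := card_fiber_unitsMap hM _
  have hp0 : (0 : ℝ) < p.totient := by exact_mod_cast Nat.totient_pos.2 hp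
  have hTle : (T.card : ℝ) ≤ ∑ b ∈ A.erase a, ((B b).card : ℝ) := by
    exact_mod_cast (Finset.card_le_card hTB).trans Finset.card_biUnion_le
  have hTle2 := hTle.trans (Finset.sum_le_sum hBle)
  rw [← Finset.mul_sum, ← Finset.mul_sum] at hTle2
  set s := ∑ b ∈ A.erase a, ((b / Nat.gcd b a).totient : ℝ)⁻¹
  have hs0 : 0 ≤ s := Finset.sum_nonneg fun _ _ => by positivity
  -- Two factors `M` pay for replacing `gcd b (a * l)` by `gcd b a`, the third for `φ(M) ≤ M`.
  have h4 : (p.totient : ℝ) ≤ p.totient * (M ^ 3 * s) := by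
    calc (p.totient : ℝ) = T.card * M.totient := by exact_mod_cast hTc.symm
      _ ≤ (p.totient * (M ^ 2 * s)) * M := by
        have : (M.totient : ℝ) ≤ M := by exact_mod_cast Nat.totient_le M
        gcongr
      _ = _ := by ring
  nlinarith

end ToeplitzShift

namespace ToeplitzShift

variable {η : ℤ → Bool} {P : PeriodChain}

/-! ### Periodic positions -/

theorem periodicPositions_congr {n : ℕ} {i : Bool} {k k' : ℤ}
    (h : (k : ZMod (P.p n)) = (k' : ZMod (P.p n))) (hk : k ∈ periodicPositions η P n i) :
    k' ∈ periodicPositions η P n i := by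
  rw [ZMod.intCast_eq_intCast_iff_dvd_sub] at h
  obtain ⟨c, hc⟩ := h
  intro j
  rw [← hk (c + j)]
  congr 1
  linear_combination hc

theorem apply_of_mem_periodicPositions {n : ℕ} {i : Bool} {k : ℤ}
    (hk : k ∈ periodicPositions η P n i) : η k = i := by
  simpa using hk 0

theorem mem_holes_iff {n : ℕ} {k : ℤ} :
    k ∈ holes η P n ↔ ∀ i, k ∉ periodicPositions η P n i := by
  simp [holes, Bool.forall_bool]

theorem holes_congr {n : ℕ} {k k' : ℤ} (h : (k : ZMod (P.p n)) = (k' : ZMod (P.p n)))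
    (hk : k ∈ holes η P n) : k' ∈ holes η P n := by
  rw [mem_holes_iff] at hk ⊢
  exact fun i hi => hk i (periodicPositions_congr h.symm hi)

theorem exists_apply_of_mem_holes {n : ℕ} {k : ℤ} (hk : k ∈ holes η P n) (i : Bool) :
    ∃ k' : ℤ, (k' : ZMod (P.p n)) = (k : ZMod (P.p n)) ∧ η k' = i := by
  rw [mem_holes_iff] at hk
  have h := hk (!i)
  simp only [periodicPositions, mem_ofPred_eq, not_forall] at h
  obtain ⟨j, hj⟩ := h
  exact ⟨k + P.p n * j, by simp, by simpa using hj⟩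

theorem periodicPositions_mono {m n : ℕ} (hmn : m ≤ n) {i : Bool} :
    periodicPositions η P m i ⊆ periodicPositions η P n i := by
  intro k hk j
  obtain ⟨q, hq⟩ := P.dvd_of_le hmn
  rw [← hk (q * j), hq]
  push_cast
  rw [mul_assoc]

/-! ### The odometer -/

namespace Odometer

theorem castHom_apply (g : Odometer P) {m n : ℕ} (h : m ≤ n) :
    ZMod.castHom (P.dvd_of_le h) (ZMod (P.p m)) (g.1 n) = g.1 m := by
  induction n, h using Nat.le_induction with
  | base => simp
  | succ n hmn ih =>
    have h1 : ZMod.castHom (P.dvd_succ n) (ZMod (P.p n)) (g.1 (n + 1)) = g.1 n := g.2 n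
    rw [← ih, ← h1]
    exact (RingHom.congr_fun (ZMod.castHom_comp (P.dvd_of_le hmn) (P.dvd_succ n)) _).symm

theorem intCast_eq_of_le (g : Odometer P) {m n : ℕ} (h : m ≤ n) {k : ℤ}
    (hk : (k : ZMod (P.p n)) = g.1 n) : (k : ZMod (P.p m)) = g.1 m := by
  rw [← castHom_apply g h, ← hk, map_intCast]

theorem apply_eq_of_le {g g' : Odometer P} {m n : ℕ} (h : m ≤ n) (hg : g.1 n = g'.1 n) :
    g.1 m = g'.1 m := by
  rw [← castHom_apply g h, hg, castHom_apply g' h]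

theorem exists_int (g : Odometer P) (n : ℕ) : ∃ k : ℤ, (k : ZMod (P.p n)) = g.1 n :=
  ZMod.intCast_surjective _

theorem continuous_apply (n : ℕ) : Continuous fun g : Odometer P => g.1 n :=
  (_root_.continuous_apply n).comp continuous_subtype_val

theorem isClopen_preimage (n : ℕ) (s : Set (ZMod (P.p n))) :
    IsClopen {g : Odometer P | g.1 n ∈ s} :=
  (isClopen_discrete s).preimage (continuous_apply n)

theorem exists_level_subset {O : Set (Odometer P)} (hO : IsOpen O) {g : Odometer P} (hg : g ∈ O)
    (N : ℕ) : ∃ n, N ≤ n ∧ ∀ g' : Odometer P, g'.1 n = g.1 n → g' ∈ O := by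
  obtain ⟨U, hU, rfl⟩ := isOpen_induced_iff.1 hO
  obtain ⟨I, u, hu, hIu⟩ := isOpen_pi_iff.1 hU g.1 hg
  refine ⟨max N (I.sup id), le_max_left _ _, fun g' hg' => hIu fun i hi => ?_⟩
  have h1 : i ≤ max N (I.sup id) := (Finset.le_sup (f := id) hi).trans (le_max_right _ _)
  rw [apply_eq_of_le h1 hg']
  exact (hu i hi).2

instance : CompactSpace (Odometer P) := by
  have : ∀ n, NeZero (P.p n) := fun n => ⟨(P.pos n).ne'⟩
  refine isCompact_iff_compactSpace.1 (IsClosed.isCompact ?_ :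
    IsCompact ((Odometer P : AddSubgroup (∀ n, ZMod (P.p n))) : Set (∀ n, ZMod (P.p n))))
  have h : ((Odometer P : AddSubgroup (∀ n, ZMod (P.p n))) : Set (∀ n, ZMod (P.p n))) =
      ⋂ n, {g | ZMod.castHom (P.dvd_succ n) (ZMod (P.p n)) (g (n + 1)) = g n} := by
    ext g
    simp [Odometer]
  rw [h]
  refine isClosed_iInter fun n => isClosed_eq ?_ (_root_.continuous_apply n)
  exact continuous_of_discreteTopology.comp (_root_.continuous_apply (n + 1))

end Odometer

theorem diag_add (k l : ℤ) : diag P (k + l) = diag P k + diag P l := by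
  apply Subtype.ext
  funext n
  simp [diag]

@[simp] theorem diag_apply (k : ℤ) (n : ℕ) : (diag P k).1 n = (k : ZMod (P.p n)) := rfl

@[simp] theorem odometer_add_apply (g g' : Odometer P) (n : ℕ) :
    (g + g').1 n = g.1 n + g'.1 n := rfl

@[simp] theorem odometer_sub_apply (g g' : Odometer P) (n : ℕ) :
    (g - g').1 n = g.1 n - g'.1 n := rfl

/-! ### The window -/

theorem mem_windowPart_iff {i : Bool} {g : Odometer P} :
    g ∈ windowPart η P i ↔
      ∃ n, ∃ k ∈ periodicPositions η P n i, (k : ZMod (P.p n)) = g.1 n := by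
  simp only [windowPart, mem_iUnion, mem_ofPred_eq, exists_prop]
  constructor
  · rintro ⟨n, k, ⟨hk, -⟩, h⟩
    exact ⟨n, k, hk, h.symm⟩
  · rintro ⟨n, k, hk, h⟩
    have hpn : (0 : ℤ) < P.p n := by exact_mod_cast P.pos n
    have e : ((k % P.p n : ℤ) : ZMod (P.p n)) = (k : ZMod (P.p n)) := by simp
    exact ⟨n, k % P.p n, ⟨periodicPositions_congr e.symm hk, Int.emod_nonneg _ hpn.ne',
      Int.emod_lt_of_pos _ hpn⟩, by rw [e, h]⟩

theorem isOpen_windowPart (i : Bool) : IsOpen (windowPart η P i) := by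
  refine isOpen_iUnion fun n => isOpen_biUnion fun k _ => ?_
  exact (Odometer.isClopen_preimage n {(k : ZMod (P.p n))}).isOpen

theorem windowPart_unique {i j : Bool} {g : Odometer P} (hi : g ∈ windowPart η P i)
    (hj : g ∈ windowPart η P j) : i = j := by
  rw [mem_windowPart_iff] at hi hj
  obtain ⟨n, k, hk, h⟩ := hi
  obtain ⟨n', k', hk', h'⟩ := hj
  obtain ⟨l, hl⟩ := Odometer.exists_int g (max n n')
  have h1 := Odometer.intCast_eq_of_le g (le_max_left n n') hl
  have h2 := Odometer.intCast_eq_of_le g (le_max_right n n') hl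
  rw [← apply_of_mem_periodicPositions (periodicPositions_congr (h.trans h1.symm) hk),
    ← apply_of_mem_periodicPositions (periodicPositions_congr (h'.trans h2.symm) hk')]

theorem forall_notMem_windowPart_iff {g : Odometer P} :
    (∀ i, g ∉ windowPart η P i) ↔
      ∀ n, ∀ k : ℤ, (k : ZMod (P.p n)) = g.1 n → k ∈ holes η P n := by
  simp only [mem_windowPart_iff, mem_holes_iff]
  constructor
  · exact fun h n k hk i hi => h i ⟨n, k, hi, hk⟩
  · rintro h i ⟨n, k, hi, hk⟩
    exact h n k hk i hi

theorem IsToeplitz.diag_mem_windowPart (h : IsToeplitz η P) (k : ℤ) :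
    diag P k ∈ windowPart η P (η k) := by
  obtain ⟨n, i, hi⟩ := h.exists_level k
  rw [apply_of_mem_periodicPositions hi]
  exact mem_windowPart_iff.2 ⟨n, k, hi, rfl⟩

/-- Near a point outside `V⁰ ∪ V¹` both symbols occur. -/
theorem exists_diag_mem {g : Odometer P} (hg : ∀ i, g ∉ windowPart η P i) {O : Set (Odometer P)}
    (hO : IsOpen O) (hgO : g ∈ O) (i : Bool) : ∃ k : ℤ, η k = i ∧ diag P k ∈ O := by
  obtain ⟨n, -, hn⟩ := Odometer.exists_level_subset hO hgO 0
  obtain ⟨k, hk⟩ := Odometer.exists_int g n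
  obtain ⟨k', hk', hi⟩ := exists_apply_of_mem_holes (forall_notMem_windowPart_iff.1 hg n k hk) i
  exact ⟨k', hi, hn _ (hk'.trans hk)⟩

/-- `V⁰` and `V¹` are open and disjoint, and by `exists_diag_mem` each point outside both is a limit
of each. So `V⁰` misses `W`, `V¹` is interior to `W`, and the remaining points are exactly the
boundary. -/
theorem IsToeplitz.mem_windowBoundary_iff' (h : IsToeplitz η P) {g : Odometer P} :
    g ∈ windowBoundary η P ↔ ∀ i, g ∉ windowPart η P i := by
  have hdisj : ∀ g' ∈ windowPart η P false, g' ∉ closure (windowPart η P true) := by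
    intro g' hg' hcl
    obtain ⟨z, hz, hz'⟩ := mem_closure_iff.1 hcl _ (isOpen_windowPart false) hg'
    exact absurd (windowPart_unique hz hz') (by simp)
  have hcl : ∀ g : Odometer P, (∀ i, g ∉ windowPart η P i) → ∀ i, g ∈ closure (windowPart η P i) := by
    intro g hg i
    refine mem_closure_iff.2 fun O hO hgO => ?_
    obtain ⟨k, hk, hkO⟩ := exists_diag_mem hg hO hgO i
    exact ⟨_, hkO, hk ▸ h.diag_mem_windowPart k⟩
  unfold windowBoundary window frontier
  rw [closure_closure]
  constructor
  · rintro ⟨h1, h2⟩ (_ | _) hi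
    · exact hdisj g hi h1
    · exact h2 (interior_maximal subset_closure (isOpen_windowPart true) hi)
  · intro hg
    refine ⟨hcl g hg true, fun hint => ?_⟩
    obtain ⟨z, hz, hz'⟩ := mem_closure_iff.1 (hcl g hg false) _ isOpen_interior hint
    exact hdisj z hz' (interior_subset hz)

theorem IsToeplitz.mem_windowBoundary_iff (h : IsToeplitz η P) {g : Odometer P} :
    g ∈ windowBoundary η P ↔
      ∀ n, ∀ k : ℤ, (k : ZMod (P.p n)) = g.1 n → k ∈ holes η P n :=
  h.mem_windowBoundary_iff'.trans forall_notMem_windowPart_iff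

theorem isClosed_windowBoundary : IsClosed (windowBoundary η P) := isClosed_frontier

/-- The essential holes are the traces of `∂W`. -/
theorem IsToeplitz.mem_essentialHoles_iff (h : IsToeplitz η P) {N : ℕ} {k : ℤ} :
    k ∈ essentialHoles η P N ↔ ∃ g ∈ windowBoundary η P, g.1 N = (k : ZMod (P.p N)) := by
  constructor
  · rintro ⟨-, hk⟩
    -- Nested non-empty closed sets of points over `k` with a hole at level `N + n`; compactness
    -- gives a common point, which has a hole at every level.
    set t : ℕ → Set (Odometer P) := fun n =>
      {g | g.1 N = (k : ZMod (P.p N)) ∧ g.1 (N + n) ∈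
        {z : ZMod (P.p (N + n)) | ∀ l : ℤ, (l : ZMod (P.p (N + n))) = z → l ∈ holes η P (N + n)}}
      with ht
    have hclosed : ∀ n, IsClosed (t n) := fun n =>
      (Odometer.isClopen_preimage N {(k : ZMod (P.p N))}).isClosed.inter
        (Odometer.isClopen_preimage (N + n) {z : ZMod (P.p (N + n)) |
          ∀ l : ℤ, (l : ZMod (P.p (N + n))) = z → l ∈ holes η P (N + n)}).isClosed
    have hhole : ∀ {a b : ℕ} (_ : a ≤ b) {g : Odometer P},
        (∀ l : ℤ, (l : ZMod (P.p b)) = g.1 b → l ∈ holes η P b) →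
        (∀ l : ℤ, (l : ZMod (P.p a)) = g.1 a → l ∈ holes η P a) := by
      intro a b hab g hg l hl
      obtain ⟨q, hq⟩ := Odometer.exists_int g b
      have h1 := Odometer.intCast_eq_of_le g hab hq
      refine holes_congr (h1.trans hl.symm) ?_
      have h2 := hg q hq
      rw [mem_holes_iff] at h2 ⊢
      exact fun i hi => h2 i (periodicPositions_mono hab hi)
    obtain ⟨g, hg⟩ := IsCompact.nonempty_iInter_of_sequence_nonempty_isCompact_isClosed t
      (fun n g hg => ⟨hg.1, hhole (Nat.le_succ (N + n)) hg.2⟩)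
      (fun n => by
        obtain ⟨j, hj⟩ := hk (N + n) (Nat.le_add_right _ _)
        exact ⟨diag P (k + P.p N * j), by simp, fun l hl => holes_congr hl.symm hj⟩)
      (hclosed 0).isCompact hclosed
    rw [mem_iInter] at hg
    refine ⟨g, h.mem_windowBoundary_iff.2 fun n => ?_, (hg 0).1⟩
    exact hhole (Nat.le_add_left n N) (hg n).2
  · rintro ⟨g, hg, hgk⟩
    rw [h.mem_windowBoundary_iff] at hg
    refine ⟨hg N k hgk.symm, fun n hn => ?_⟩
    obtain ⟨l, hl⟩ := Odometer.exists_int g n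
    have h1 := (Odometer.intCast_eq_of_le g hn hl).trans hgk
    rw [eq_comm, ZMod.intCast_eq_intCast_iff_dvd_sub] at h1
    obtain ⟨c, hc⟩ := h1
    exact ⟨c, by rw [← hc, add_sub_cancel]; exact hg n l hl⟩

theorem IsToeplitz.essentialHoles_congr (h : IsToeplitz η P) {n : ℕ} {k k' : ℤ}
    (hkk : (k : ZMod (P.p n)) = (k' : ZMod (P.p n))) (hk : k ∈ essentialHoles η P n) :
    k' ∈ essentialHoles η P n := by
  rw [h.mem_essentialHoles_iff] at hk ⊢
  rwa [← hkk]

theorem IsToeplitz.essentialHoles_anti (h : IsToeplitz η P) {m n : ℕ} (hmn : m ≤ n) :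
    essentialHoles η P n ⊆ essentialHoles η P m := by
  intro k hk
  rw [h.mem_essentialHoles_iff] at hk ⊢
  obtain ⟨g, hg, hgk⟩ := hk
  exact ⟨g, hg, (Odometer.intCast_eq_of_le g hmn hgk.symm).symm⟩

/-! ### Fibres of the factor map -/

instance : CompactSpace (orbitClosure η) := isCompact_iff_compactSpace.1 isClosed_closure.isCompact

theorem continuous_symbol (i : ℤ) : Continuous fun x : orbitClosure η => (x : ℤ → Bool) i :=
  (continuous_apply i).comp continuous_subtype_val

/-- The point `σ^k η` of `X_η`. -/
def orbitPoint (η : ℤ → Bool) (k : ℤ) : orbitClosure η :=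
  ⟨fun i => η (i + k), subset_closure ⟨k, rfl⟩⟩

theorem orbitPoint_zero : orbitPoint η 0 = base η := by
  apply Subtype.ext
  funext i
  change η (i + 0) = η i
  rw [add_zero]

theorem shift_orbitPoint (k : ℤ) : shift η (orbitPoint η k) = orbitPoint η (k + 1) := by
  apply Subtype.ext
  funext i
  change η (i + 1 + k) = η (i + (k + 1))
  congr 1
  ring

theorem dense_range_orbitPoint : DenseRange (orbitPoint η) := by
  intro x
  rw [closure_subtype]
  have hx := x.2
  unfold orbitClosure at hx
  convert hx using 2
  rw [← range_comp]
  rfl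

theorem zpow_shift_orbitPoint (k l : ℤ) :
    (shift η ^ k) (orbitPoint η l) = orbitPoint η (l + k) := by
  induction k using Int.induction_on with
  | zero => simp
  | succ k ih =>
    rw [add_comm (k : ℤ) 1, zpow_add, zpow_one, Homeomorph.mul_apply, ih, shift_orbitPoint]
    congr 1
    ring
  | pred k ih =>
    apply (shift η).injective
    rw [shift_orbitPoint, ← Homeomorph.mul_apply, ← zpow_one_add, add_sub_cancel, ih]
    congr 1
    ring

theorem IsFactorMap.apply_zpow_shift {π : orbitClosure η → Odometer P} (hπ : IsFactorMap η P π)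
    (k : ℤ) (x : orbitClosure η) : π ((shift η ^ k) x) = π x + diag P k := by
  induction k using Int.induction_on generalizing x with
  | zero =>
    have : diag P 0 = 0 := by apply Subtype.ext; funext n; simp [diag]
    simp [this]
  | succ k ih =>
    rw [add_comm (k : ℤ) 1, zpow_add, zpow_one, Homeomorph.mul_apply, hπ.2.1, ih, diag_add]
    abel
  | pred k ih =>
    have h1 := hπ.2.1 ((shift η ^ (-(k : ℤ) - 1)) x)
    rw [← Homeomorph.mul_apply, ← zpow_one_add, add_sub_cancel, ih] at h1
    have h2 : diag P (-(k : ℤ)) = diag P (-(k : ℤ) - 1) + diag P 1 := by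
      rw [← diag_add]; congr 1; ring
    rw [h2, ← add_assoc] at h1
    exact (add_right_cancel h1).symm

theorem IsFactorMap.apply_orbitPoint {π : orbitClosure η → Odometer P} (hπ : IsFactorMap η P π)
    (k : ℤ) : π (orbitPoint η k) = diag P k := by
  have h1 := hπ.apply_zpow_shift k (orbitPoint η 0)
  rwa [zpow_shift_orbitPoint, zero_add, orbitPoint_zero, hπ.2.2, zero_add] at h1

/-- The symbol at a position that `π x` places in `V^b` is `b`. -/
theorem IsFactorMap.apply_eq_of_mem_windowPart {π : orbitClosure η → Odometer P}
    (hπ : IsFactorMap η P π) {x : orbitClosure η} {i : ℤ} {b : Bool}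
    (hb : π x + diag P i ∈ windowPart η P b) : (x : ℤ → Bool) i = b := by
  obtain ⟨n, k, hk, hkn⟩ := mem_windowPart_iff.1 hb
  set O : Set (orbitClosure η) := {x' | (π x').1 n = (π x).1 n} ∩
    {x' | (x' : ℤ → Bool) i = (x : ℤ → Bool) i} with hO
  have hOo : IsOpen O := by
    refine IsOpen.inter ?_ ?_
    · exact (Odometer.isClopen_preimage n {(π x).1 n}).isOpen.preimage hπ.1
    · exact (isOpen_discrete {(x : ℤ → Bool) i}).preimage (continuous_symbol i)
  obtain ⟨j, hj1, hj2⟩ := dense_range_orbitPoint.exists_mem_open hOo ⟨x, rfl, rfl⟩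
  have hj1' : (π (orbitPoint η j)).1 n = (π x).1 n := hj1
  rw [hπ.apply_orbitPoint, diag_apply] at hj1'
  have hj2' : η (i + j) = (x : ℤ → Bool) i := hj2
  rw [← hj2']
  refine apply_of_mem_periodicPositions (periodicPositions_congr ?_ hk)
  rw [hkn, odometer_add_apply, ← hj1', diag_apply]
  push_cast
  ring

theorem IsFactorMap.apply_eq_of_notMem (h : IsToeplitz η P) {π : orbitClosure η → Odometer P}
    (hπ : IsFactorMap η P π) {x x' : orbitClosure η} (hx : π x = π x') {i : ℤ}
    (hi : π x + diag P i ∉ windowBoundary η P) : (x : ℤ → Bool) i = (x' : ℤ → Bool) i := by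
  rw [h.mem_windowBoundary_iff'] at hi
  push Not at hi
  obtain ⟨b, hb⟩ := hi
  rw [hπ.apply_eq_of_mem_windowPart hb, hπ.apply_eq_of_mem_windowPart (hx ▸ hb)]

/-- Every integer translate of `Δ(k)` lies in `V⁰ ∪ V¹`, so the fibre over it has no free
coordinate. -/
theorem IsFactorMap.eq_orbitPoint (h : IsToeplitz η P) {π : orbitClosure η → Odometer P}
    (hπ : IsFactorMap η P π) {x : orbitClosure η} {k : ℤ} (hx : π x = diag P k) :
    x = orbitPoint η k := by
  apply Subtype.ext
  funext i
  refine hπ.apply_eq_of_mem_windowPart ?_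
  rw [hx, ← diag_add, add_comm]
  exact h.diag_mem_windowPart (i + k)

/-- The image under `π` of `{x | x 0 = b}` is compact and contains `Δ(k)` whenever `η k = b`; such
points accumulate at `g`. -/
theorem IsFactorMap.exists_fiber (h : IsToeplitz η P) {π : orbitClosure η → Odometer P}
    (hπ : IsFactorMap η P π) {g : Odometer P} (hg : g ∈ windowBoundary η P) (b : Bool) :
    ∃ x, π x = g ∧ (x : ℤ → Bool) 0 = b := by
  have hcl : IsClosed {x : orbitClosure η | (x : ℤ → Bool) 0 = b} :=
    (isClosed_discrete {b}).preimage (continuous_symbol 0)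
  have hcl' := (hcl.isCompact.image hπ.1).isClosed
  have hmem : g ∈ π '' {x : orbitClosure η | (x : ℤ → Bool) 0 = b} := by
    rw [← hcl'.closure_eq]
    refine mem_closure_iff.2 fun O hO hgO => ?_
    obtain ⟨k, hk, hkO⟩ := exists_diag_mem (h.mem_windowBoundary_iff'.1 hg) hO hgO b
    refine ⟨_, hkO, orbitPoint η k, ?_, hπ.apply_orbitPoint k⟩
    change η (0 + k) = b
    rw [zero_add, hk]
  obtain ⟨x, hx, hxg⟩ := hmem
  exact ⟨x, hxg, hx⟩

/-! ### Automorphisms -/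

theorem commute_apply {F : orbitClosure η ≃ₜ orbitClosure η} (hF : F ∈ automorphismGroup η)
    (x : orbitClosure η) : F (shift η x) = shift η (F x) := by
  have h1 := Subgroup.mem_centralizer_singleton_iff.1 hF
  rw [← Homeomorph.mul_apply, h1, Homeomorph.mul_apply]

theorem commute_zpow_apply {F : orbitClosure η ≃ₜ orbitClosure η} (hF : F ∈ automorphismGroup η)
    (k : ℤ) (x : orbitClosure η) : F ((shift η ^ k) x) = (shift η ^ k) (F x) := by
  have h1 : Commute F (shift η) := Subgroup.mem_centralizer_singleton_iff.1 hF
  rw [← Homeomorph.mul_apply, (h1.zpow_right k).eq, Homeomorph.mul_apply]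

/-- `x ↦ π (F x) - y_F` is again a normalized factor map, so uniqueness applies. -/
theorem factorMap_apply_automorphism (h : IsToeplitz η P)
    {F : orbitClosure η ≃ₜ orbitClosure η} (hF : F ∈ automorphismGroup η) (x : orbitClosure η) :
    factorMap h (F x) = factorMap h x + translation h F := by
  have hπ := factorMap_spec h
  have h1 : IsFactorMap η P fun x => factorMap h (F x) - translation h F := by
    refine ⟨(hπ.1.comp F.continuous).sub continuous_const, fun x => ?_, sub_self _⟩
    simp only [commute_apply hF, hπ.2.1]
    abel
  have h2 := congrFun (factorMap_unique h1 hπ) x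
  rw [← h2]
  simp

theorem eq_zpow_shift_of_translation_eq (h : IsToeplitz η P)
    {F : orbitClosure η ≃ₜ orbitClosure η} (hF : F ∈ automorphismGroup η) {k : ℤ}
    (hk : translation h F = diag P k) : F = shift η ^ k := by
  have h1 : F (base η) = orbitPoint η k := (factorMap_spec h).eq_orbitPoint h hk
  ext1 x
  refine congrFun (dense_range_orbitPoint.equalizer F.continuous (shift η ^ k).continuous ?_) x
  funext l
  simp only [Function.comp_apply]
  have h2 : orbitPoint η l = (shift η ^ l) (base η) := by
    rw [← orbitPoint_zero, zpow_shift_orbitPoint, zero_add]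
  rw [zpow_shift_orbitPoint, h2, commute_zpow_apply hF, h1, zpow_shift_orbitPoint, add_comm]

/-- Automorphisms map fibres of `π` to fibres, so `∂W - y_F` lies in the orbit of `∂W`. -/
theorem exists_mem_of_add_translation_mem (h : IsToeplitz η P)
    {F : orbitClosure η ≃ₜ orbitClosure η} (hF : F ∈ automorphismGroup η) {m : ℕ}
    (hm : HasBlockCode F m) {g : Odometer P} (hg : g + translation h F ∈ windowBoundary η P) :
    ∃ j : ℤ, |j| ≤ m ∧ g + diag P j ∈ windowBoundary η P := by
  by_contra hcon
  push Not at hcon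
  have hπ := factorMap_spec h
  obtain ⟨x, hx, hx0⟩ := hπ.exists_fiber h hg false
  obtain ⟨x', hx', hx0'⟩ := hπ.exists_fiber h hg true
  have hfib : ∀ z, factorMap h z = g + translation h F → factorMap h (F.symm z) = g := by
    intro z hz
    have := factorMap_apply_automorphism h hF (F.symm z)
    rw [F.apply_symm_apply, hz] at this
    exact (add_right_cancel this).symm
  -- `x` and `x'` differ at `0`, yet their preimages lie over `g` and, if no `g + Δ(j)` with `|j| ≤
  -- m` is in `∂W`, agree on `[-m, m]`, which is all the block code of `F` sees.
  obtain ⟨f, hf⟩ := hm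
  have e := hf (F.symm x) 0
  have e' := hf (F.symm x') 0
  rw [F.apply_symm_apply] at e e'
  have : (x : ℤ → Bool) 0 = (x' : ℤ → Bool) 0 := by
    rw [e, e']
    congr 1
    funext j
    rw [zero_add]
    refine hπ.apply_eq_of_notMem h ((hfib x hx).trans (hfib x' hx').symm) ?_
    rw [hfib x hx]
    exact hcon _ (abs_le.2 ⟨j.2.1, j.2.2⟩)
  rw [hx0, hx0'] at this
  simp at this

/-- Otherwise `F` would identify two points over `g` that differ at `0`. No bound on `j` is obtained
here; the bound on `K` comes from `abs_le_of_mem_shiftSet`. -/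
theorem exists_mem_add_translation (h : IsToeplitz η P)
    {F : orbitClosure η ≃ₜ orbitClosure η} (hF : F ∈ automorphismGroup η)
    {g : Odometer P} (hg : g ∈ windowBoundary η P) :
    ∃ j : ℤ, g + translation h F + diag P j ∈ windowBoundary η P := by
  by_contra hcon
  push Not at hcon
  have hπ := factorMap_spec h
  obtain ⟨x, hx, hx0⟩ := hπ.exists_fiber h hg false
  obtain ⟨x', hx', hx0'⟩ := hπ.exists_fiber h hg true
  have hFx : F x = F x' := by
    apply Subtype.ext
    funext i
    refine hπ.apply_eq_of_notMem h ?_ ?_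
    · rw [factorMap_apply_automorphism h hF, factorMap_apply_automorphism h hF, hx, hx']
    · rw [factorMap_apply_automorphism h hF, hx]
      exact hcon i
  rw [F.injective hFx, hx0'] at hx0
  simp at hx0

end ToeplitzShift

namespace ToeplitzShift

variable {η : ℤ → Bool} {P : PeriodChain} {A : ℕ → Set ℕ} {S : ℕ → ℕ → Set ℕ}

/-! ### Divisibility of translations by the elements of `A_n` -/

theorem mem_multiples_sdiff_of_dvd {a : ℕ} {T : Set ℕ} {x y : ℤ}
    (hx : x ∈ multiples {a} \ multiples T) (hay : (a : ℤ) ∣ y) (hyx : y ∣ x) :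
    y ∈ multiples {a} \ multiples T :=
  ⟨⟨a, rfl, hay⟩, fun ⟨s, hs, hsy⟩ => hx.2 ⟨s, hs, hsy.trans hyx⟩⟩

theorem dvd_of_mem_multiples_sdiff {a : ℕ} {T : Set ℕ} {x : ℤ}
    (hx : x ∈ multiples {a} \ multiples T) : (a : ℤ) ∣ x := by
  obtain ⟨⟨b, rfl, hb⟩, -⟩ := hx
  exact hb

namespace HasArithmeticStructure

theorem subset_essentialHoles (hAS : HasArithmeticStructure η P A S) {n a : ℕ} (ha : a ∈ A n) :
    multiples {a} \ multiples (S n a) ⊆ essentialHoles η P n := by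
  rw [hAS.essentialHoles_eq]
  exact subset_biUnion_of_mem (u := fun a => multiples {a} \ multiples (S n a)) ha

theorem exists_mem_piece (hAS : HasArithmeticStructure η P A S) {n : ℕ} {x : ℤ}
    (hx : x ∈ essentialHoles η P n) : ∃ a ∈ A n, x ∈ multiples {a} \ multiples (S n a) := by
  rw [hAS.essentialHoles_eq] at hx
  simpa only [mem_iUnion, exists_prop] using hx

theorem isPrimitivelyCovered (hAS : HasArithmeticStructure η P A S) (h : IsToeplitz η P) (n : ℕ) :
    IsPrimitivelyCovered (essentialHoles η P n) (P.p n) (A n) where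
  pos := hAS.pos n
  primitive := hAS.primitive n
  mem a ha := by
    obtain ⟨x, hx⟩ := hAS.nonempty n a ha
    exact hAS.subset_essentialHoles ha
      (mem_multiples_sdiff_of_dvd hx dvd_rfl (dvd_of_mem_multiples_sdiff hx))
  cover x hx := by
    obtain ⟨a, ha, hxa⟩ := hAS.exists_mem_piece hx
    exact ⟨a, ha, dvd_of_mem_multiples_sdiff hxa, fun y hay hyx =>
      hAS.subset_essentialHoles ha (mem_multiples_sdiff_of_dvd hxa hay hyx)⟩
  periodic x y hxy hx := h.essentialHoles_congr hxy hx

theorem dvd_p (hAS : HasArithmeticStructure η P A S) (h : IsToeplitz η P) {n a : ℕ}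
    (ha : a ∈ A n) : a ∣ P.p n :=
  (hAS.isPrimitivelyCovered h n).dvd_period (P.pos n) ha

end HasArithmeticStructure

theorem toReal_tsum_inv_totient {B : Set ℕ} (hB : B.Finite) (hpos : ∀ b ∈ B, 0 < b) (a : ℕ) :
    (∑' b : ↥(B \ {a}), ((Nat.totient ((b : ℕ) / Nat.gcd b a) : ℝ≥0∞))⁻¹).toReal =
      ∑ b ∈ hB.toFinset.erase a, ((b / Nat.gcd b a).totient : ℝ)⁻¹ := by
  have hset : B \ {a} = ((hB.toFinset.erase a : Finset ℕ) : Set ℕ) := by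
    ext; simp
  rw [hset, Finset.tsum_subtype' (hB.toFinset.erase a)
    (fun b : ℕ => ((Nat.totient (b / Nat.gcd b a) : ℝ≥0∞))⁻¹), ENNReal.toReal_sum]
  · simp
  · intro b hb
    have hb0 : 0 < b := hpos b (by simpa using Finset.mem_of_mem_erase hb)
    have : 0 < (b / Nat.gcd b a).totient := Nat.totient_pos.2
      (Nat.div_pos (Nat.gcd_le_left _ hb0) (Nat.gcd_pos_of_pos_left _ hb0))
    simpa using this.ne'

/-- If translation by `z` maps the part of `∂W` over a residue class mod `p_N` into `∂W`, then for
large `n` every `a ∈ A_n` whose piece meets this class divides `z_n`. -/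
theorem eventually_dvd_of_translate (h : IsToeplitz η P) (hAS : HasArithmeticStructure η P A S)
    (hA : SummabilityCondition A) {z g : Odometer P} {N : ℕ} (hg : g ∈ windowBoundary η P)
    (hz : ∀ g' ∈ windowBoundary η P, g'.1 N = g.1 N → g' + z ∈ windowBoundary η P) :
    ∀ᶠ n in atTop, ∀ a ∈ A n, ∀ x ∈ multiples {a} \ multiples (S n a),
      (x : ZMod (P.p N)) = g.1 N → ∀ r : ℤ, (r : ZMod (P.p n)) = z.1 n → (a : ℤ) ∣ r := by
  classical
  set M := P.p N with hM
  have hM0 : 0 < M := P.pos N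
  set Bad : ℕ → ℕ → Prop := fun n a => a ∈ A n ∧ ∃ x ∈ multiples {a} \ multiples (S n a),
    (x : ZMod M) = g.1 N ∧ ∃ r : ℤ, (r : ZMod (P.p n)) = z.1 n ∧ ¬ (a : ℤ) ∣ r with hBad
  have hne : ∀ n, ∃ a, a ∈ A n := by
    intro n
    obtain ⟨k, hk⟩ := Odometer.exists_int g n
    obtain ⟨a, ha, -⟩ := hAS.exists_mem_piece (h.mem_essentialHoles_iff.2 ⟨g, hg, hk.symm⟩)
    exact ⟨a, ha⟩
  -- The summability condition concerns one sequence at a time, so a counterexample is selected at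
  -- every level that has one.
  have hchoice : ∀ n, ∃ a ∈ A n, (∃ b, Bad n b) → Bad n a := by
    intro n
    by_cases hb : ∃ b, Bad n b
    · obtain ⟨b, hb⟩ := hb
      exact ⟨b, hb.1, fun _ => hb⟩
    · obtain ⟨a, ha⟩ := hne n
      exact ⟨a, ha, fun h => absurd h hb⟩
  choose a haA haBad using hchoice
  have hε : (0 : ℝ≥0∞) < ENNReal.ofReal (((M : ℝ) ^ 3)⁻¹) := by
    rw [ENNReal.ofReal_pos]
    positivity
  filter_upwards [(hA a haA).eventually_lt_const hε, eventually_ge_atTop N] with n hn hNn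
  by_contra hcon
  push Not at hcon
  obtain ⟨b, hbA, x₀, hx₀, hx₀g, r₀, hr₀, hbr₀⟩ := hcon
  obtain ⟨-, x, hx, hxg, r, hr, har⟩ := haBad n ⟨b, hbA, x₀, hx₀, hx₀g, r₀, hr₀, hbr₀⟩
  have hC := hAS.isPrimitivelyCovered h n
  have hfin := hC.finite (P.pos n)
  have hsum : (M : ℝ) ^ 3 *
      ∑ b ∈ hfin.toFinset.erase (a n), ((b / Nat.gcd b (a n)).totient : ℝ)⁻¹ < 1 := by
    rw [← toReal_tsum_inv_totient hfin hC.pos]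
    have hlt := ENNReal.toReal_lt_of_lt_ofReal hn
    have hM3 : (0 : ℝ) < (M : ℝ) ^ 3 := by positivity
    calc _ < (M : ℝ) ^ 3 * ((M : ℝ) ^ 3)⁻¹ := mul_lt_mul_of_pos_left hlt hM3
      _ = 1 := mul_inv_cancel₀ hM3.ne'
  -- With `x = a w` and `l = gcd w M`, the number `a l` divides `x` and stays in the piece of `a`.
  -- Choosing `t ≡ u` mod `M` makes `a l t ≡ x`, so the hole `a l t` comes from a point of `∂W` in
  -- the cylinder of `g`.
  obtain ⟨w, hw⟩ := dvd_of_mem_multiples_sdiff hx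
  obtain ⟨u, hu, huw⟩ := exists_coprime_mul_gcd M hM0 w
  have hlM : Int.gcd w M ∣ M := by exact_mod_cast Int.gcd_dvd_right w (M : ℤ)
  obtain ⟨t, ht, htu, hnot⟩ := exists_coprime_forall_not_dvd (P.pos n) (P.dvd_of_le hNn)
    hfin.toFinset (fun b hb => hC.dvd_period (P.pos n) (by simpa using hb)) (a n) (Int.gcd w M) u
    hlM hu r har hsum
  have hy : ((a n * Int.gcd w M : ℕ) : ℤ) ∈ essentialHoles η P n := by
    refine hAS.subset_essentialHoles (haA n) (mem_multiples_sdiff_of_dvd hx ?_ ?_)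
    · push_cast; exact dvd_mul_right _ _
    · rw [hw]; push_cast; exact mul_dvd_mul_left _ (Int.gcd_dvd_left w (M : ℤ))
  obtain ⟨g', hg', hg't⟩ := h.mem_essentialHoles_iff.1 (hC.mul_mem_of_coprime (P.pos n) hy ht)
  have hg'N : g'.1 N = g.1 N := by
    rw [← Odometer.intCast_eq_of_le g' hNn hg't.symm, ← hxg, hw]
    push_cast at huw ⊢
    rw [htu, mul_assoc, huw]
  have hmem := hz g' hg' hg'N
  have hmem' : ((a n * Int.gcd w M : ℕ) : ℤ) * t + r ∈ essentialHoles η P n := by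
    refine h.mem_essentialHoles_iff.2 ⟨_, hmem, ?_⟩
    rw [odometer_add_apply, hg't, ← hr]
    push_cast
    rfl
  obtain ⟨c, hcA, hc⟩ := hC.exists_dvd hmem'
  exact hnot c (by simpa using hcA) hc

theorem IsToeplitz.eventually_notMem_essentialHoles (h : IsToeplitz η P) (k : ℤ) :
    ∀ᶠ n in atTop, k ∉ essentialHoles η P n := by
  obtain ⟨N, i, hi⟩ := h.exists_level k
  filter_upwards [eventually_ge_atTop N] with n hn hk
  exact mem_holes_iff.1 hk.1 i (periodicPositions_mono hn hi)

theorem exists_piece_over (h : IsToeplitz η P) (hAS : HasArithmeticStructure η P A S)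
    {g : Odometer P} (hg : g ∈ windowBoundary η P) {N n : ℕ} (hNn : N ≤ n) :
    ∃ a ∈ A n, ∃ x ∈ multiples {a} \ multiples (S n a), (x : ZMod (P.p N)) = g.1 N := by
  obtain ⟨x, hx⟩ := Odometer.exists_int g n
  obtain ⟨a, ha, hxa⟩ := hAS.exists_mem_piece (h.mem_essentialHoles_iff.2 ⟨g, hg, hx.symm⟩)
  exact ⟨a, ha, x, hxa, Odometer.intCast_eq_of_le g hNn hx⟩

/-- No non-trivial integer translate of `∂W` contains a non-empty relatively open part of `∂W`. -/
theorem eq_zero_of_translate_diag (h : IsToeplitz η P) (hAS : HasArithmeticStructure η P A S)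
    (hA : SummabilityCondition A) {l : ℤ} {g : Odometer P} {N : ℕ} (hg : g ∈ windowBoundary η P)
    (hl : ∀ g' ∈ windowBoundary η P, g'.1 N = g.1 N → g' + diag P l ∈ windowBoundary η P) :
    l = 0 := by
  by_contra hl0
  -- An `a ∈ A_n` dividing `l ≠ 0` would be an essential hole in `[1, |l|]`; each of these finitely
  -- many integers eventually stops being one.
  have h1 : ∀ᶠ n in atTop, ∀ k ∈ Icc (1 : ℤ) |l|, k ∉ essentialHoles η P n := by
    rw [(Set.finite_Icc (1 : ℤ) |l|).eventually_all]
    exact fun k _ => h.eventually_notMem_essentialHoles k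
  obtain ⟨n, hn, hn', hNn⟩ := ((eventually_dvd_of_translate h hAS hA hg hl).and
    (h1.and (eventually_ge_atTop N))).exists
  obtain ⟨a, ha, x, hx, hxg⟩ := exists_piece_over h hAS hg hNn
  have hal := hn a ha x hx hxg l rfl
  refine hn' a ⟨by exact_mod_cast hAS.pos n a ha, ?_⟩ ((hAS.isPrimitivelyCovered h n).mem a ha)
  exact Int.le_of_dvd (abs_pos.2 hl0) ((dvd_abs _ _).2 hal)

/-! ### The set `K_F` -/

theorem mem_shiftSet_iff (h : IsToeplitz η P) {F : orbitClosure η ≃ₜ orbitClosure η} {k : ℤ} :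
    k ∈ shiftSet h F ↔ ∃ g ∈ windowBoundary η P, ∃ N, ∀ g' ∈ windowBoundary η P,
      g'.1 N = g.1 N → g' + (translation h F - diag P k) ∈ windowBoundary η P := by
  have hov : ∀ g ∈ windowBoundary η P, (g ∈ overlap h F k ↔
      g + (translation h F - diag P k) ∈ windowBoundary η P) := by
    intro g hg
    constructor
    · rintro ⟨-, b, hb, rfl⟩
      convert hb using 1
      abel
    · exact fun hb => ⟨hg, _, hb, by abel⟩
  constructor
  · rintro ⟨g, hg⟩
    obtain ⟨t, ht, hto, hgt⟩ := mem_interior.1 hg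
    obtain ⟨O, hO, rfl⟩ := isOpen_induced_iff.1 hto
    obtain ⟨n, -, hn⟩ := Odometer.exists_level_subset hO hgt 0
    exact ⟨g, g.2, n, fun g' hg' hgn => (hov g' hg').1 (ht (a := ⟨g', hg'⟩) (hn g' hgn))⟩
  · rintro ⟨g, hg, N, hN⟩
    refine ⟨⟨g, hg⟩, mem_interior.2 ⟨Subtype.val ⁻¹' {g' : Odometer P | g'.1 N ∈ ({g.1 N} : Set _)},
      fun g' hg' => (hov g' g'.2).2 (hN g' g'.2 hg'), ?_, rfl⟩⟩
    exact (Odometer.isClopen_preimage N {g.1 N}).isOpen.preimage continuous_subtype_val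

/-- Baire's theorem on a relatively clopen part of `∂W`. -/
theorem exists_level_of_iUnion {ι : Type*} [Countable ι] {f : ι → Set (Odometer P)}
    (hf : ∀ i, IsClosed (f i)) {g : Odometer P} (hg : g ∈ windowBoundary η P) (N : ℕ)
    (hcov : ∀ g' ∈ windowBoundary η P, g'.1 N = g.1 N → ∃ i, g' ∈ f i) :
    ∃ i, ∃ g₁ ∈ windowBoundary η P, ∃ n, N ≤ n ∧ g₁.1 N = g.1 N ∧
      ∀ g' ∈ windowBoundary η P, g'.1 n = g₁.1 n → g' ∈ f i := by
  set X : Set (Odometer P) := windowBoundary η P ∩ {g' | g'.1 N ∈ ({g.1 N} : Set _)} with hX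
  have hXc : IsClosed X := isClosed_windowBoundary.inter (Odometer.isClopen_preimage N _).isClosed
  have : CompactSpace X := isCompact_iff_compactSpace.1 hXc.isCompact
  have : Nonempty X := ⟨⟨g, hg, rfl⟩⟩
  obtain ⟨i, g₁, hg₁⟩ := nonempty_interior_of_iUnion_of_closed
    (f := fun i => (Subtype.val ⁻¹' f i : Set X))
    (fun i => (hf i).preimage continuous_subtype_val)
    (eq_univ_of_forall fun g' => mem_iUnion.2 (hcov g' g'.2.1 g'.2.2))
  obtain ⟨t, ht, hto, hgt⟩ := mem_interior.1 hg₁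
  obtain ⟨O, hO, rfl⟩ := isOpen_induced_iff.1 hto
  obtain ⟨n, hNn, hn⟩ := Odometer.exists_level_subset hO hgt N
  exact ⟨i, g₁, g₁.2.1, n, hNn, g₁.2.2, fun g' hg' hgn =>
    ht (a := ⟨g', hg', (Odometer.apply_eq_of_le hNn hgn).trans g₁.2.2⟩) (hn g' hgn)⟩

theorem isClosed_translate (z : Odometer P) : IsClosed {g | g + z ∈ windowBoundary η P} :=
  isClosed_windowBoundary.preimage (continuous_id.add continuous_const)

/-- Baire applied to the countable closed cover of `∂W` provided by `exists_mem_add_translation`. -/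
theorem exists_level_shiftSet (h : IsToeplitz η P) {F : orbitClosure η ≃ₜ orbitClosure η}
    (hF : F ∈ automorphismGroup η) {g : Odometer P} (hg : g ∈ windowBoundary η P) (N : ℕ) :
    ∃ k ∈ shiftSet h F, ∃ g₁ ∈ windowBoundary η P, ∃ n, N ≤ n ∧ g₁.1 N = g.1 N ∧
      ∀ g' ∈ windowBoundary η P, g'.1 n = g₁.1 n →
        g' + (translation h F - diag P k) ∈ windowBoundary η P := by
  obtain ⟨k, g₁, hg₁, n, hn, hgN, hk⟩ := exists_level_of_iUnion
    (f := fun k : ℤ => {g | g + (translation h F - diag P k) ∈ windowBoundary η P})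
    (fun k => isClosed_translate _) hg N (fun g' hg' _ => by
      obtain ⟨j, hj⟩ := exists_mem_add_translation h hF hg'
      refine ⟨-j, ?_⟩
      have e : g' + (translation h F - diag P (-j)) = g' + translation h F + diag P j := by
        apply Subtype.ext
        funext i
        simp [add_assoc]
      rwa [mem_ofPred_eq, e])
  exact ⟨k, (mem_shiftSet_iff h).2 ⟨g₁, hg₁, n, hk⟩, g₁, hg₁, n, hn, hgN, hk⟩

/-- On an open piece where `k` works, the block code gives, for each `g'`, some `|j| ≤ m` with `g' +
Δ(j - k) ∈ ∂W`. By Baire one `j` serves a smaller piece, and `eq_zero_of_translate_diag` gives `j =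
k`. -/
theorem abs_le_of_mem_shiftSet (h : IsToeplitz η P) (hAS : HasArithmeticStructure η P A S)
    (hA : SummabilityCondition A) {F : orbitClosure η ≃ₜ orbitClosure η}
    (hF : F ∈ automorphismGroup η) {m : ℕ} (hm : HasBlockCode F m) {k : ℤ}
    (hk : k ∈ shiftSet h F) : |k| ≤ m := by
  obtain ⟨g, hg, N, hN⟩ := (mem_shiftSet_iff h).1 hk
  obtain ⟨⟨j, hj⟩, g₁, hg₁, n, -, -, hn⟩ := exists_level_of_iUnion
    (f := fun j : {j : ℤ // |j| ≤ m} => {g | g + diag P (j - k) ∈ windowBoundary η P})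
    (fun k => isClosed_translate _) hg N (fun g' hg' hgN => by
      have h1 := hN g' hg' hgN
      rw [show g' + (translation h F - diag P k) = g' - diag P k + translation h F by abel] at h1
      obtain ⟨j, hj, hj'⟩ := exists_mem_of_add_translation_mem h hF hm h1
      refine ⟨⟨j, hj⟩, ?_⟩
      have e : g' + diag P (j - k) = g' - diag P k + diag P j := by
        apply Subtype.ext
        funext i
        simp only [odometer_add_apply, odometer_sub_apply, diag_apply]
        push_cast
        ring
      rwa [mem_ofPred_eq, e])
  have := eq_zero_of_translate_diag h hAS hA hg₁ hn
  rwa [← sub_eq_zero.1 this]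

theorem natCast_dvd_of_intCast_eq {n a : ℕ} {r : ℤ} {z : ZMod n} (hr : (r : ZMod n) = z)
    (ha : (a : ℤ) ∣ r) : (a : ZMod n) ∣ z := by
  obtain ⟨c, rfl⟩ := ha
  exact ⟨c, by rw [← hr]; push_cast; rfl⟩

theorem dvd_of_natCast_dvd_intCast {n a : ℕ} (han : a ∣ n) {r : ℤ}
    (h : (a : ZMod n) ∣ (r : ZMod n)) : (a : ℤ) ∣ r := by
  obtain ⟨c, hc⟩ := h
  obtain ⟨c, rfl⟩ := ZMod.intCast_surjective c
  have h1 : ((a * c : ℤ) : ZMod n) = (r : ZMod n) := by rw [hc]; push_cast; rfl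
  rw [ZMod.intCast_eq_intCast_iff_dvd_sub] at h1
  have h2 : (a : ℤ) ∣ r - a * c := (Int.natCast_dvd_natCast.2 han).trans h1
  exact (dvd_sub_left (dvd_mul_right _ _)).1 h2

theorem dvd_sub_of_dvd_offset {h : IsToeplitz η P} {F : orbitClosure η ≃ₜ orbitClosure η}
    {n a a' b : ℕ} (hb : b ∣ P.p n) (hba : b ∣ a) (hba' : b ∣ a') {k k' : ℤ}
    (hk : (a : ZMod (P.p n)) ∣ offset h F n k) (hk' : (a' : ZMod (P.p n)) ∣ offset h F n k') :
    (b : ℤ) ∣ k - k' := by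
  refine dvd_of_natCast_dvd_intCast hb ?_
  have h1 : ((k - k' : ℤ) : ZMod (P.p n)) = offset h F n k' - offset h F n k := by
    unfold offset
    push_cast
    ring
  rw [h1]
  exact dvd_sub ((Nat.cast_dvd_cast hba').trans hk') ((Nat.cast_dvd_cast hba).trans hk)

/-- Divisibility is known only at large levels. It descends because an element of `A n'` is an
essential hole at level `n ≤ n'`, hence a multiple of some element of `A n`. -/
theorem exists_dvd_offset_of_mem_shiftSet (h : IsToeplitz η P)
    (hAS : HasArithmeticStructure η P A S) (hA : SummabilityCondition A)
    {F : orbitClosure η ≃ₜ orbitClosure η} (n : ℕ) {k : ℤ} (hk : k ∈ shiftSet h F) :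
    ∃ a ∈ A n, (a : ZMod (P.p n)) ∣ offset h F n k := by
  obtain ⟨g, hg, N, hN⟩ := (mem_shiftSet_iff h).1 hk
  obtain ⟨n', h1, hn, hN'⟩ := ((eventually_dvd_of_translate h hAS hA hg hN).and
    ((eventually_ge_atTop n).and (eventually_ge_atTop N))).exists
  obtain ⟨a, ha, x, hx, hxg⟩ := exists_piece_over h hAS hg hN'
  obtain ⟨r, hr⟩ := Odometer.exists_int (translation h F - diag P k) n'
  obtain ⟨b, hb, hba⟩ := (hAS.isPrimitivelyCovered h n).exists_dvd
    (h.essentialHoles_anti hn ((hAS.isPrimitivelyCovered h n').mem a ha))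
  exact ⟨b, hb, natCast_dvd_of_intCast_eq (Odometer.intCast_eq_of_le _ hn hr)
    (hba.trans (h1 a ha x hx hxg r hr))⟩

/-- Baire is applied to the part of `∂W` over the residue `a`. At a large level this yields a
divisor `a'` of the offset, lying over some `b ∈ A n`; `b` divides a number congruent to `a` mod
`p_n`, and also `p_n`, so `b ∣ a` and primitivity gives `b = a`. -/
theorem exists_mem_shiftSet_dvd_offset (h : IsToeplitz η P)
    (hAS : HasArithmeticStructure η P A S) (hA : SummabilityCondition A)
    {F : orbitClosure η ≃ₜ orbitClosure η} (hF : F ∈ automorphismGroup η) {n a : ℕ}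
    (ha : a ∈ A n) : ∃ k ∈ shiftSet h F, (a : ZMod (P.p n)) ∣ offset h F n k := by
  have hC := hAS.isPrimitivelyCovered h
  obtain ⟨g, hg, hga⟩ := h.mem_essentialHoles_iff.1 ((hC n).mem a ha)
  obtain ⟨k, hk, g₁, hg₁, N, hnN, hgN, hN⟩ := exists_level_shiftSet h hF hg n
  obtain ⟨n', h1, hNn'⟩ := ((eventually_dvd_of_translate h hAS hA hg₁ hN).and
    (eventually_ge_atTop N)).exists
  obtain ⟨a', ha', x, hx, hxg⟩ := exists_piece_over h hAS hg₁ hNn'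
  obtain ⟨r, hr⟩ := Odometer.exists_int (translation h F - diag P k) n'
  have hxa : ((a : ℤ) : ZMod (P.p n)) = (x : ZMod (P.p n)) := by
    rw [Odometer.intCast_eq_of_le g₁ hnN hxg, hgN, hga]
  rw [ZMod.intCast_eq_intCast_iff_dvd_sub] at hxa
  obtain ⟨b, hb, hba'⟩ := (hC n).exists_dvd
    (h.essentialHoles_anti (hnN.trans hNn') ((hC n').mem a' ha'))
  have hbx : (b : ℤ) ∣ x := hba'.trans (dvd_of_mem_multiples_sdiff hx)
  have hba : (b : ℤ) ∣ a :=
    (dvd_sub_right hbx).1 ((Int.natCast_dvd_natCast.2 (hAS.dvd_p h hb)).trans hxa)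
  have hab := hAS.primitive n a ha b hb (by exact_mod_cast hba)
  subst hab
  exact ⟨k, hk, natCast_dvd_of_intCast_eq (Odometer.intCast_eq_of_le _ (hnN.trans hNn') hr)
    (hba'.trans (h1 a' ha' x hx hxg r hr))⟩

/-! ### Translations preserving the boundary -/

/-- The exceptional points form a relatively open subset of `∂W`. If it were non-empty,
`exists_level_shiftSet` would find an element of `K` working on a piece of it, and this can only be
`k`. -/
theorem add_mem_windowBoundary_of_shiftSet_eq (h : IsToeplitz η P)
    {F : orbitClosure η ≃ₜ orbitClosure η} (hF : F ∈ automorphismGroup η) {k : ℤ}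
    (hK : shiftSet h F = {k}) {g : Odometer P} (hg : g ∈ windowBoundary η P) :
    g + (translation h F - diag P k) ∈ windowBoundary η P := by
  by_contra hcon
  obtain ⟨n, -, hn⟩ := Odometer.exists_level_subset
    (isClosed_translate (η := η) (translation h F - diag P k)).isOpen_compl hcon 0
  obtain ⟨k', hk', g₁, hg₁, N, -, hgN, hN⟩ := exists_level_shiftSet h hF hg n
  rw [hK, mem_singleton_iff] at hk'
  subst hk'
  exact hn g₁ hgN (hN g₁ hg₁ rfl)

/-- A one-sided inclusion suffices: `p_n - 1` further translations by `r` lead from `k + r` to `k +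
p_n r`, which is `k` modulo `p_n`. So `r` is a period, and the periods form a subgroup of `ℤ`. -/
theorem essentialPeriod_dvd (h : IsToeplitz η P) {n : ℕ} {r : ℤ}
    (hr : ∀ k ∈ essentialHoles η P n, k + r ∈ essentialHoles η P n) :
    (essentialPeriod η P n : ℤ) ∣ r := by
  let D : AddSubgroup ℤ :=
    { carrier := {t | ∀ k, k + t ∈ essentialHoles η P n ↔ k ∈ essentialHoles η P n}
      zero_mem' := fun k => by rw [add_zero]
      add_mem' := fun {s t} hs ht k => by rw [← add_assoc, ht, hs]
      neg_mem' := fun {t} ht k => by rw [← ht (k + -t), neg_add_cancel_right] }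
  have hp : ∀ c : ℤ, (P.p n * c : ℤ) ∈ D := fun c k =>
    ⟨h.essentialHoles_congr (by simp), h.essentialHoles_congr (by simp)⟩
  have hrD : r ∈ D := by
    refine fun k => ⟨fun hk => ?_, hr k⟩
    have h1 : ∀ j : ℕ, k + r + j * r ∈ essentialHoles η P n := by
      intro j
      induction j with
      | zero => simpa using hk
      | succ j ih =>
        convert hr _ ih using 1
        push_cast
        ring
    have h2 := h1 (P.p n - 1)
    rw [Nat.cast_sub (P.pos n)] at h2
    refine (hp r k).1 ?_
    convert h2 using 1
    push_cast
    ring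
  obtain ⟨hT, hTD⟩ : essentialPeriod η P n ∈ {t : ℕ | 0 < t ∧
      ∀ k : ℤ, k + t ∈ essentialHoles η P n ↔ k ∈ essentialHoles η P n} :=
    Nat.sInf_mem ⟨P.p n, P.pos n, fun k => by simpa using hp 1 k⟩
  have hT' : (0 : ℤ) < essentialPeriod η P n := by exact_mod_cast hT
  by_contra hcon
  have hmod : r % essentialPeriod η P n ∈ D := by
    have h3 : (essentialPeriod η P n : ℤ) ∈ D := hTD
    have h4 := D.sub_mem hrD (D.zsmul_mem h3 (r / essentialPeriod η P n))
    rwa [smul_eq_mul, mul_comm, ← Int.emod_def] at h4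
  have h0 := Int.emod_nonneg r hT'.ne'
  have hlt := Int.emod_lt_of_pos r hT'
  rw [Int.dvd_iff_emod_eq_zero] at hcon
  have hle : essentialPeriod η P n ≤ (r % essentialPeriod η P n).toNat :=
    Nat.sInf_le ⟨by omega, by rw [Int.toNat_of_nonneg h0]; exact hmod⟩
  omega

theorem essentialPeriod_dvd_offset (h : IsToeplitz η P)
    {F : orbitClosure η ≃ₜ orbitClosure η} (hF : F ∈ automorphismGroup η) {k : ℤ}
    (hK : shiftSet h F = {k}) (n : ℕ) :
    (essentialPeriod η P n : ZMod (P.p n)) ∣ offset h F n k := by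
  obtain ⟨r, hr⟩ := Odometer.exists_int (translation h F - diag P k) n
  refine natCast_dvd_of_intCast_eq hr (essentialPeriod_dvd h fun l hl => ?_)
  rw [h.mem_essentialHoles_iff] at hl ⊢
  obtain ⟨g, hg, hgl⟩ := hl
  refine ⟨_, add_mem_windowBoundary_of_shiftSet_eq h hF hK hg, ?_⟩
  rw [odometer_add_apply, hgl, ← hr]
  push_cast
  rfl

theorem mem_zpowers_of_shiftSet_eq (h : IsToeplitz η P) (hτ : ∀ n, essentialPeriod η P n = P.p n)
    {F : orbitClosure η ≃ₜ orbitClosure η} (hF : F ∈ automorphismGroup η) {k : ℤ}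
    (hK : shiftSet h F = {k}) : F ∈ Subgroup.zpowers (shift η) := by
  refine ⟨k, (eq_zpow_shift_of_translation_eq h hF ?_).symm⟩
  apply Subtype.ext
  funext n
  have h1 := essentialPeriod_dvd_offset h hF hK n
  rw [hτ, ZMod.natCast_self, zero_dvd_iff] at h1
  exact sub_eq_zero.1 h1

end ToeplitzShift

/-! ### Assembly of the five assertions -/

theorem theorem2p22 (η : ℤ → Bool) (P : PeriodChain) (h : IsToeplitz η P)
    (A : ℕ → Set ℕ) (S : ℕ → ℕ → Set ℕ) (hAS : HasArithmeticStructure η P A S)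
    (hA : SummabilityCondition A)
    (F : orbitClosure η ≃ₜ orbitClosure η) (hF : F ∈ automorphismGroup η)
    (m : ℕ) (hm : HasBlockCode F m) :
    (∀ n, ∀ k ∈ shiftSet h F, ∃ a ∈ A n, (a : ZMod (P.p n)) ∣ offset h F n k) ∧
    (∀ n, ∀ a ∈ A n,
      (∃ k ∈ shiftSet h F, (a : ZMod (P.p n)) ∣ offset h F n k) ∧
      (2 * m < a → ∃! k, k ∈ shiftSet h F ∧ (a : ZMod (P.p n)) ∣ offset h F n k)) ∧
    (∀ n, (∀ a ∈ A n, 2 * m < a) →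
      (∀ a a' : A n, (gcdGraph (A n) (2 * m)).Reachable a a' →
        ∀ k ∈ shiftSet h F, ∀ k' ∈ shiftSet h F,
          ((a : ℕ) : ZMod (P.p n)) ∣ offset h F n k →
          ((a' : ℕ) : ZMod (P.p n)) ∣ offset h F n k' → k = k') ∧
      ((gcdGraph (A n) (2 * m)).Connected → ∃ k, shiftSet h F = {k})) ∧
    (∀ k, shiftSet h F = {k} →
      ∀ n, (essentialPeriod η P n : ZMod (P.p n)) ∣ offset h F n k) ∧
    ((∀ n, essentialPeriod η P n = P.p n) →
      ((∃ k, shiftSet h F = {k}) → F ∈ Subgroup.zpowers (shift η)) ∧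
      ((∀ F' ∈ automorphismGroup η, ∃ k, shiftSet h F' = {k}) →
        automorphismGroup η = Subgroup.zpowers (shift η))) := by
  -- Elements of `K` lie in `[-m, m]`, so their differences are at most `2m < c` in absolute value.
  have huniq : ∀ {c : ℕ} {k k' : ℤ}, 2 * m < c → k ∈ shiftSet h F → k' ∈ shiftSet h F →
      (c : ℤ) ∣ k - k' → k = k' := by
    intro c k k' hc hk hk' hdvd
    have h1 := abs_le.1 (abs_le_of_mem_shiftSet h hAS hA hF hm hk)
    have h2 := abs_le.1 (abs_le_of_mem_shiftSet h hAS hA hF hm hk')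
    refine sub_eq_zero.1 (Int.eq_zero_of_abs_lt_dvd hdvd ?_)
    rw [abs_lt]
    omega
  have hreach : ∀ n, (∀ a ∈ A n, 2 * m < a) →
      ∀ a a' : A n, (gcdGraph (A n) (2 * m)).Reachable a a' →
        ∀ k ∈ shiftSet h F, ∀ k' ∈ shiftSet h F,
          ((a : ℕ) : ZMod (P.p n)) ∣ offset h F n k →
          ((a' : ℕ) : ZMod (P.p n)) ∣ offset h F n k' → k = k' := by
    rintro n hn a a' ⟨w⟩
    induction w with
    | nil =>
      intro k hk k' hk' hak hak'
      exact huniq (hn _ (Subtype.coe_prop _)) hk hk'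
        (dvd_sub_of_dvd_offset (hAS.dvd_p h (Subtype.coe_prop _)) dvd_rfl dvd_rfl hak hak')
    | @cons u v w huv _ ih =>
      -- Existence in b) supplies some `k₁` attached to the neighbour `v`; `gcd u v` divides both
      -- offsets, hence `k - k₁`.
      intro k hk k' hk' huk hwk'
      obtain ⟨k₁, hk₁, hvk₁⟩ := exists_mem_shiftSet_dvd_offset h hAS hA hF v.2
      rw [← ih k₁ hk₁ k' hk' hvk₁ hwk']
      have hgcd : 2 * m < Nat.gcd u v := by
        rcases ((SimpleGraph.fromRel_adj _ _ _).1 huv).2 with h1 | h1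
        · exact h1
        · rwa [Nat.gcd_comm]
      exact huniq hgcd hk hk₁ (dvd_sub_of_dvd_offset
        ((Nat.gcd_dvd_left _ _).trans (hAS.dvd_p h u.2))
        (Nat.gcd_dvd_left _ _) (Nat.gcd_dvd_right _ _) huk hvk₁)
  refine ⟨fun n k hk => exists_dvd_offset_of_mem_shiftSet h hAS hA n hk, fun n a ha => ?_,
    fun n hn => ⟨hreach n hn, fun hconn => ?_⟩,
    fun k hK n => essentialPeriod_dvd_offset h hF hK n, fun hτ => ⟨?_, fun hall => ?_⟩⟩
  · obtain ⟨k, hk, hak⟩ := exists_mem_shiftSet_dvd_offset h hAS hA hF ha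
    refine ⟨⟨k, hk, hak⟩, fun ham => ⟨k, ⟨hk, hak⟩, fun k' hk' => ?_⟩⟩
    exact huniq ham hk'.1 hk (dvd_sub_of_dvd_offset (hAS.dvd_p h ha) dvd_rfl dvd_rfl hk'.2 hak)
  · obtain ⟨a⟩ := hconn.nonempty
    obtain ⟨k, hk, hak⟩ := exists_mem_shiftSet_dvd_offset h hAS hA hF a.2
    refine ⟨k, Subset.antisymm (fun k' hk' => ?_) (singleton_subset_iff.2 hk)⟩
    obtain ⟨a', ha', hak'⟩ := exists_dvd_offset_of_mem_shiftSet h hAS hA n hk'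
    exact hreach n hn ⟨a', ha'⟩ a (hconn.preconnected _ _) k' hk' k hk hak' hak
  · rintro ⟨k, hK⟩
    exact mem_zpowers_of_shiftSet_eq h hτ hF hK
  · refine le_antisymm (fun F' hF' => ?_) ?_
    · obtain ⟨k, hK⟩ := hall F' hF'
      exact mem_zpowers_of_shiftSet_eq h hτ hF' hK
    · rw [Subgroup.zpowers_le]
      exact Subgroup.mem_centralizer_singleton_iff.2 rfl
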